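/- Fix integers $n\ge 2$ and $\ell_1,\ell_2\ge 1$. For $\ell\ge1$ let $B_\ell$ be the $sl_n$ crystal of one-row semistandard tableaux of length $\ell$ with letters in $\{1,\dots,n\}$; such a tableau is written as its entries $\alpha_1\le\dots\le\alpha_\ell$ or as $x=(x_1,\dots,x_n)\in\mathbb Z_{\ge0}^n$, $\sum_k x_k=\ell$, where $x_k$ is the number of letters $k$. Let $B_\natural$ be the $sl_n$ crystal of columns $(\alpha,\beta)$ with $1\le\alpha<\beta\le n$. For $1\le i\le n-1$: on $B_\ell$, $\tilde f_i$ replaces one $i$ by $i+1$ (and is $0$ if there is no $i$), $\varphi_i(x)=x_i$, $\varepsilon_i(x)=x_{i+1}$; on $B_\natural$, $\tilde f_i$ replaces $i$ by $i+1$ if $i$ appears and $i+1$ does not (and is $0$ otherwise), and $\varphi_i$ (resp. $\varepsilon_i$) is $1$ if $i$ appears and $i+1$ does not (resp. $i+1$ appears and $i$ does not), and $0$ otherwise. On a tensor product (the direct product as a set) $\tilde f_i(b\otimes b')=\tilde f_ib\otimes b'$ if $\varphi_i(b)>\varepsilon_i(b')$, and $b\otimes\tilde f_ib'$ otherwise.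 An isomorphism of crystals is a bijection commuting with all $\tilde f_i$ (with $0\mapsto0$). Define $R:B_\ell\otimes B_m\to B_m\otimes B_\ell$, $(x,y)\mapsto(x',y')$, by $$x'_i=y_i+P_{i+1}-P_i,\quad y'_i=x_i+P_i-P_{i+1},\quad P_i=\max_{1\le j\le n}\Big(\sum_{k=1}^{j-1}(y_{k+i-1}-x_{k+i-1})+y_{j+i-1}\Big),$$ with indices modulo $n$. Define $\iota'':B_\ell\otimes B_\natural\to B_\natural\otimes B_\ell$ on $(\alpha_1\le\dots\le\alpha_\ell)\otimes(\beta,\gamma)$ as follows, with $\alpha_{\ell+1}=\infty$; the outgoing column is * $(\alpha_i,\alpha_j)$ if $\alpha_i<\beta\le\alpha_{i+1}$ and $\alpha_j<\gamma\le\alpha_{j+1}$ with $1\le i<j\le\ell$; * $(\alpha_i,\beta)$ if $\alpha_i<\beta$ and $\gamma\le\alpha_{i+1}$ with $1\le i\le\ell$; * $(\alpha_i,\alpha_\ell)$ if $\beta\le\alpha_1$ and $\alpha_i<\gamma\le\alpha_{i+1}$ with $0\le i<\ell$, where $\alpha_0:=\beta$ in this case; * $(\alpha_\ell,\gamma)$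 if $\beta\le\alpha_1$ and $\gamma>\alpha_\ell$; and the outgoing row consists of the remaining letters of $\alpha_1,\dots,\alpha_\ell,\beta,\gamma$. Define $(\iota'')^{-1}:B_\natural\otimes B_\ell\to B_\ell\otimes B_\natural$ on $(\alpha,\beta)\otimes(\gamma_1\le\dots\le\gamma_\ell)$ as follows, with $\gamma_0=-\infty$; the outgoing column is * $(\gamma_1,\beta)$ if $\gamma_\ell\le\alpha$; * $(\gamma_1,\gamma_i)$ if $\gamma_{i-1}\le\alpha<\gamma_i$ and $\gamma_\ell\le\beta$ with $2\le i\le\ell$; * $(\alpha,\gamma_1)$ if $\alpha<\gamma_1$ and $\gamma_\ell\le\beta$; * $(\gamma_i,\gamma_j)$ if $\gamma_{i-1}\le\alpha<\gamma_i$ and $\gamma_{j-1}\le\beta<\gamma_j$ with $1\le i<j\le\ell$; * $(\beta,\gamma_i)$ if $\gamma_{i-1}\le\alpha$ and $\beta<\gamma_i$ with $1\le i\le\ell$; and the outgoing row consists of the remaining letters. Let $\sigma$ denote whichever of $R$, $\iota''$, $(\iota'')^{-1}$ applies to a given pair of factors, and put $\sigma_1(b_1\otimes b_2\otimes b_3)=\sigma(b_1\otimes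 b_2)\otimes b_3$, $\sigma_2(b_1\otimes b_2\otimes b_3)=b_1\otimes\sigma(b_2\otimes b_3)$. **Lemma.** $R:B_{\ell_1}\otimes B_{\ell_2}\to B_{\ell_2}\otimes B_{\ell_1}$ and $\iota'':B_{\ell_1}\otimes B_\natural\to B_\natural\otimes B_{\ell_1}$ are isomorphisms of $sl_n$ crystals, the map $(\iota'')^{-1}$ is the two-sided inverse of $\iota''$, and $$\sigma_1\sigma_2\sigma_1=\sigma_2\sigma_1\sigma_2$$ holds on $B_{\ell_1}\otimes B_{\ell_2}\otimes B_\natural$, as well as on $B_{\ell_1}\otimes B_\natural\otimes B_{\ell_2}$ and on $B_\natural\otimes B_{\ell_1}\otimes B_{\ell_2}$. -/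

import Mathlib

namespace ColouredBBS

/-- The data of an `sl_n` crystal used here: the maps `f_i` from `B` to `B ⊔ {0}`
(with `none` in the role of `0`) and the maps `φ_i`, `ε_i`, for the indices
`i ∈ {1, …, n-1}`, which are numbered `0, …, n-2`. -/
structure Crystal (n : ℕ) where
  carrier : Type
  f : Fin (n - 1) → carrier → Option carrier
  phi : Fin (n - 1) → carrier → ℕ
  eps : Fin (n - 1) → carrier → ℕ

/-- The tensor product of crystals: the direct product as a set, with
`f_i (b ⊗ b') = f_i b ⊗ b'` if `φ_i b > ε_i b'` and `b ⊗ f_i b'` otherwise. -/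
def Crystal.tensor {n : ℕ} (B C : Crystal n) : Crystal n where
  carrier := B.carrier × C.carrier
  f i b :=
    if C.eps i b.2 < B.phi i b.1 then (B.f i b.1).map (fun c => (c, b.2))
    else (C.f i b.2).map (fun c => (b.1, c))
  phi i b := max (C.phi i b.2) (B.phi i b.1 + C.phi i b.2 - C.eps i b.2)
  eps i b := max (B.eps i b.1) (B.eps i b.1 + C.eps i b.2 - B.phi i b.1)

/-- An isomorphism of crystals: a bijection commuting with all `f_i` (and with `0 ↦ 0`). -/
def IsCrystalIso {n : ℕ} (B C : Crystal n) (g : B.carrier → C.carrier) : Prop :=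
  Function.Bijective g ∧ ∀ i b, C.f i (g b) = (B.f i b).map g

/-- The letter `i`, for a crystal index `i`. The letters `1, …, n` are numbered `0, …, n-1`. -/
def lo {n : ℕ} (i : Fin (n - 1)) : Fin n := ⟨i.1, by have := i.2; omega⟩

/-- The letter `i + 1`, for a crystal index `i`. -/
def hi {n : ℕ} (i : Fin (n - 1)) : Fin n := ⟨i.1 + 1, by have := i.2; omega⟩

/-- The elements of `B_ℓ`: one-row semistandard tableaux of length `ℓ`, given by the
number `x k` of times that each letter `k` appears. -/
abbrev Row (n ℓ : ℕ) : Type := {x : Fin n → ℕ // ∑ k, x k = ℓ}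

/-- The elements of `B_♮`: columns with entries `α < β` (`α` on top). -/
abbrev Domino (n : ℕ) : Type := {d : Fin n × Fin n // d.1 < d.2}

theorem sum_exchange {n : ℕ} (x a b : Fin n → ℕ) (hab : ∑ k, a k = ∑ k, b k)
    (h : ∀ k, b k ≤ x k + a k) : ∑ k, (x k + a k - b k) = ∑ k, x k := by
  have h1 : ∑ k, (x k + a k - b k) + ∑ k, b k = ∑ k, (x k + a k) := by
    rw [← Finset.sum_add_distrib]
    exact Finset.sum_congr rfl fun k _ => Nat.sub_add_cancel (h k)
  rw [Finset.sum_add_distrib] at h1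
  omega

/-- `f_i` on `B_ℓ`: replace one letter `i` by `i + 1` if there is an `i`; otherwise `0`. -/
def rowF {n ℓ : ℕ} (i : Fin (n - 1)) (x : Row n ℓ) : Option (Row n ℓ) :=
  if h : 0 < x.1 (lo i) then
    some ⟨fun k => x.1 k + (if k = hi i then 1 else 0) - (if k = lo i then 1 else 0), by
      rw [sum_exchange, x.2]
      · simp
      · intro k
        by_cases hk : k = lo i
        · subst hk; simp only [if_true]; omega
        · simp [hk]⟩
  else none

/-- The crystal `B_ℓ`. -/
def rowCrystal (n ℓ : ℕ) : Crystal n where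
  carrier := Row n ℓ
  f := rowF
  phi i x := x.1 (lo i)
  eps i x := x.1 (hi i)

/-- The letter `k` appears in the column `d`. -/
def Domino.Has {n : ℕ} (d : Domino n) (k : Fin n) : Prop := k = d.1.1 ∨ k = d.1.2

instance {n : ℕ} (d : Domino n) (k : Fin n) : Decidable (d.Has k) :=
  inferInstanceAs (Decidable (_ ∨ _))

/-- `f_i` on `B_♮`: replace `i` by `i + 1` if `i` appears and `i + 1` does not; otherwise `0`. -/
def dominoF {n : ℕ} (i : Fin (n - 1)) (d : Domino n) : Option (Domino n) :=
  if h : d.Has (lo i) ∧ ¬ d.Has (hi i) then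
    some ⟨(if d.1.1 = lo i then hi i else d.1.1, if d.1.2 = lo i then hi i else d.1.2), by
      obtain ⟨⟨a, b⟩, hab⟩ := d
      simp only [Domino.Has, lo, hi, Fin.ext_iff, Fin.lt_def] at h hab ⊢
      split_ifs <;> simp_all <;> omega⟩
  else none

/-- The crystal `B_♮`. -/
def dominoCrystal (n : ℕ) : Crystal n where
  carrier := Domino n
  f := dominoF
  phi i d := if d.Has (lo i) ∧ ¬ d.Has (hi i) then 1 else 0
  eps i d := if d.Has (hi i) ∧ ¬ d.Has (lo i) then 1 else 0

/-! ### The piecewise linear map `R` -/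

/-- The `j`-th expression in the maximum that defines `P_i` (with `j` starting at `0`):
`∑_{k<j} (y_{i+k} - x_{i+k}) + y_{i+j}`, indices modulo `n`. -/
def term {n : ℕ} [NeZero n] (x y : Fin n → ℕ) (i : Fin n) (j : ℕ) : ℤ :=
  ∑ k ∈ Finset.range j, ((y (i + Fin.ofNat n k) : ℤ) - x (i + Fin.ofNat n k))
    + y (i + Fin.ofNat n j)

/-- `P_i = max_{0 ≤ j < n} (∑_{k<j} (y_{i+k} - x_{i+k}) + y_{i+j})`, indices modulo `n`. -/
def P {n : ℕ} [NeZero n] (x y : Fin n → ℕ) (i : Fin n) : ℤ :=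
  (Finset.range n).sup' (Finset.nonempty_range_iff.2 (NeZero.ne n)) (term x y i)

theorem term_le_P {n : ℕ} [NeZero n] (x y : Fin n → ℕ) (i : Fin n) {j : ℕ} (hj : j < n) :
    term x y i j ≤ P x y i :=
  Finset.le_sup' (term x y i) (Finset.mem_range.2 hj)

theorem term_zero {n : ℕ} [NeZero n] (x y : Fin n → ℕ) (i : Fin n) : term x y i 0 = y i := by
  simp [term]

theorem ofNat_succ_aux {n : ℕ} [NeZero n] (i : Fin n) (k : ℕ) :
    i + Fin.ofNat n (k + 1) = i + 1 + Fin.ofNat n k := by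
  apply Fin.ext
  simp [Fin.val_add, Fin.coe_ofNat_eq_mod]
  congr 1
  omega

theorem term_succ {n : ℕ} [NeZero n] (x y : Fin n → ℕ) (i : Fin n) (j : ℕ) :
    term x y i (j + 1) = (y i : ℤ) - x i + term x y (i + 1) j := by
  unfold term
  rw [Finset.sum_range_succ', ofNat_succ_aux]
  simp only [ofNat_succ_aux]
  simp
  ring

theorem sum_cyclic {n : ℕ} [NeZero n] (g : Fin n → ℤ) (i : Fin n) :
    ∑ k ∈ Finset.range n, g (i + Fin.ofNat n k) = ∑ k, g k := by
  rw [← Fin.sum_univ_eq_sum_range (fun k => g (i + Fin.ofNat n k)) n]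
  have : ∀ k : Fin n, Fin.ofNat n k.1 = k := fun k => by
    apply Fin.ext; simp
  simp only [this]
  exact Fintype.sum_equiv (Equiv.addLeft i) _ _ (fun _ => rfl)

theorem term_last {n : ℕ} [NeZero n] (x y : Fin n → ℕ) (i : Fin n) :
    ∑ k, ((y k : ℤ) - x k) ≤ term x y i (n - 1) := by
  have hn : n - 1 + 1 = n := Nat.sub_add_cancel (Nat.pos_of_ne_zero (NeZero.ne n))
  have h := sum_cyclic (fun k => (y k : ℤ) - x k) i
  have hr : Finset.range n = Finset.range (n - 1 + 1) := by rw [hn]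
  rw [← h, hr, Finset.sum_range_succ]
  unfold term
  have : (0 : ℤ) ≤ x (i + Fin.ofNat n (n - 1)) := Int.natCast_nonneg _
  linarith

theorem R_fst_nonneg {n : ℕ} [NeZero n] (x y : Fin n → ℕ) (i : Fin n) :
    0 ≤ (y i : ℤ) + P x y (i + 1) - P x y i := by
  have hn : 0 < n := Nat.pos_of_ne_zero (NeZero.ne n)
  have h0 : (0 : ℤ) ≤ P x y (i + 1) := by
    have := term_le_P x y (i + 1) hn
    rw [term_zero] at this
    omega
  have : P x y i ≤ y i + P x y (i + 1) := by
    refine Finset.sup'_le _ _ fun j hj => ?_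
    rw [Finset.mem_range] at hj
    cases j with
    | zero => rw [term_zero]; omega
    | succ j =>
      rw [term_succ]
      have := term_le_P x y (i + 1) (j := j) (by omega)
      omega
  omega

theorem R_snd_nonneg {n : ℕ} [NeZero n] (x y : Fin n → ℕ) (i : Fin n) :
    0 ≤ (x i : ℤ) + P x y i - P x y (i + 1) := by
  have hn : 0 < n := Nat.pos_of_ne_zero (NeZero.ne n)
  have : P x y (i + 1) ≤ x i + P x y i := by
    refine Finset.sup'_le _ _ fun j hj => ?_
    rw [Finset.mem_range] at hj
    by_cases hj' : j + 1 < n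
    · have h1 := term_le_P x y i hj'
      rw [term_succ] at h1
      omega
    · have hjn : j + 1 = n := by omega
      have h1 := term_succ x y i j
      have h2 := term_le_P x y i (j := n - 1) (by omega)
      have h3 := term_last x y i
      have h4 : term x y i (j + 1) = ∑ k, ((y k : ℤ) - x k) + y i := by
        rw [hjn, ← sum_cyclic (fun k => (y k : ℤ) - x k) i]
        unfold term
        congr 3
        apply Fin.ext
        simp
      omega
  omega

theorem sum_shift {n : ℕ} [NeZero n] (p : Fin n → ℤ) : ∑ i, p (i + 1) = ∑ i, p i :=
  Fintype.sum_equiv (Equiv.addRight 1) _ _ (fun _ => rfl)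

/-- The map `R : B_ℓ ⊗ B_m → B_m ⊗ B_ℓ`, `(x, y) ↦ (x', y')` with
`x'_i = y_i + P_{i+1} - P_i` and `y'_i = x_i + P_i - P_{i+1}`, indices modulo `n`.
(The values are nonnegative, so that `Int.toNat` only changes the type.) -/
def R (n ℓ m : ℕ) [NeZero n] (b : Row n ℓ × Row n m) : Row n m × Row n ℓ :=
  (⟨fun i => ((b.2.1 i : ℤ) + P b.1.1 b.2.1 (i + 1) - P b.1.1 b.2.1 i).toNat, by
      zify
      simp only [Int.toNat_of_nonneg (R_fst_nonneg b.1.1 b.2.1 _), Finset.sum_sub_distrib,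
        Finset.sum_add_distrib, sum_shift]
      rw [add_sub_cancel_right]
      exact_mod_cast b.2.2⟩,
   ⟨fun i => ((b.1.1 i : ℤ) + P b.1.1 b.2.1 i - P b.1.1 b.2.1 (i + 1)).toNat, by
      zify
      simp only [Int.toNat_of_nonneg (R_snd_nonneg b.1.1 b.2.1 _), Finset.sum_sub_distrib,
        Finset.sum_add_distrib, sum_shift]
      rw [add_sub_cancel_right]
      exact_mod_cast b.1.2⟩)

/-! ### The map `ι''` and its inverse

In both maps the letters of the tensor product as a whole are preserved, so that the outgoing
row is determined by the outgoing column. -/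

/-- The letters of a row. -/
def letters {n : ℕ} (x : Fin n → ℕ) : Finset (Fin n) := Finset.univ.filter (fun k => 0 < x k)

/-- The letters of a row that are smaller than `b`. -/
def below {n : ℕ} (x : Fin n → ℕ) (b : Fin n) : Finset (Fin n) :=
  Finset.univ.filter (fun k => 0 < x k ∧ k < b)

/-- The letters of a row that are larger than `b`. -/
def above {n : ℕ} (x : Fin n → ℕ) (b : Fin n) : Finset (Fin n) :=
  Finset.univ.filter (fun k => 0 < x k ∧ b < k)

/-- The column obtained by `ι''` from the row with the letters `α_1 ≤ … ≤ α_ℓ` and the column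
`β < γ`. The letter `α_i` with `α_i < β ≤ α_{i+1}` is the largest letter of the row below `β`,
and likewise for `γ`. The cases are, in this order:
`(α_i, α_j)` if `α_i < β ≤ α_{i+1}` and `α_j < γ ≤ α_{j+1}` with `i ≠ j`;
`(α_i, β)` if `α_i < β` and `γ ≤ α_{i+1}`;
`(α_i, α_ℓ)` if `β ≤ α_1` and `α_i < γ ≤ α_{i+1}` with `i < ℓ`, where `α_0 = β`
(so `(β, α_ℓ)` if `γ ≤ α_1`);
`(α_ℓ, γ)` if `β ≤ α_1` and `γ > α_ℓ`.
Here `α_{ℓ+1} = ∞`. (The last value is for the empty row.) -/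
def iotaColumn {n : ℕ} (x : Fin n → ℕ) (β γ : Fin n) : Fin n × Fin n :=
  if hβ : (below x β).Nonempty then
    if hγ : (below x γ).Nonempty then
      if (below x β).max' hβ < (below x γ).max' hγ then
        ((below x β).max' hβ, (below x γ).max' hγ)
      else ((below x β).max' hβ, β)
    else (β, γ) -- impossible for `β < γ`
  else
    if hx : (letters x).Nonempty then
      if γ ≤ (letters x).max' hx then
        if hγ : (below x γ).Nonempty then ((below x γ).max' hγ, (letters x).max' hx)
        else (β, (letters x).max' hx)
      else ((letters x).max' hx, γ)
    else (β, γ)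

/-- The column obtained by `(ι'')⁻¹` from the column `α < β` and the row with the letters
`γ_1 ≤ … ≤ γ_ℓ`. The letter `γ_i` with `γ_{i-1} ≤ α < γ_i` is the smallest letter of the row
above `α`, and likewise for `β`. The cases are, in this order:
`(γ_i, γ_j)` if `γ_{i-1} ≤ α < γ_i` and `γ_{j-1} ≤ β < γ_j` with `i ≠ j`;
`(β, γ_i)` if `γ_{i-1} ≤ α` and `β < γ_i`;
`(γ_1, γ_i)` if `γ_{i-1} ≤ α < γ_i` with `i > 1` and `γ_ℓ ≤ β`;
`(α, γ_1)` if `α < γ_1` and `γ_ℓ ≤ β`;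
`(γ_1, β)` if `γ_ℓ ≤ α`.
Here `γ_0 = -∞`. (The last value is for the empty row.) -/
def iotaInvColumn {n : ℕ} (x : Fin n → ℕ) (α β : Fin n) : Fin n × Fin n :=
  if hx : (letters x).Nonempty then
    if hα : (above x α).Nonempty then
      if hβ : (above x β).Nonempty then
        if (above x α).min' hα < (above x β).min' hβ then
          ((above x α).min' hα, (above x β).min' hβ)
        else (β, (above x α).min' hα)
      else
        if (letters x).min' hx ≤ α then ((letters x).min' hx, (above x α).min' hα)
        else (α, (letters x).min' hx)
    else ((letters x).min' hx, β)
  else (α, β)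

/-- `d'` is a column whose letters occur in the row `x` or the column `d`. -/
def IsExchange {n : ℕ} (x : Fin n → ℕ) (d d' : Fin n × Fin n) : Prop :=
  d'.1 < d'.2 ∧ (0 < x d'.1 ∨ d'.1 = d.1 ∨ d'.1 = d.2) ∧ (0 < x d'.2 ∨ d'.2 = d.1 ∨ d'.2 = d.2)

theorem iotaColumn_isExchange {n : ℕ} (x : Fin n → ℕ) (β γ : Fin n) (h : β < γ) :
    IsExchange x (β, γ) (iotaColumn x β γ) := by
  have mb : ∀ c (hc : (below x c).Nonempty),
      0 < x ((below x c).max' hc) ∧ (below x c).max' hc < c := fun c hc => by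
    simpa [below] using (below x c).max'_mem hc
  have ml : ∀ (hc : (letters x).Nonempty), 0 < x ((letters x).max' hc) := fun hc => by
    simpa [letters] using (letters x).max'_mem hc
  unfold iotaColumn IsExchange
  split_ifs with h1 h2 h3 h4 h5 h6
  · exact ⟨h3, .inl (mb _ h1).1, .inl (mb _ h2).1⟩
  · exact ⟨(mb _ h1).2, .inl (mb _ h1).1, .inr (.inl rfl)⟩
  · exact ⟨h, .inr (.inl rfl), .inr (.inr rfl)⟩
  · exact ⟨lt_of_lt_of_le (mb _ h6).2 h5, .inl (mb _ h6).1, .inl (ml h4)⟩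
  · exact ⟨lt_of_lt_of_le h h5, .inr (.inl rfl), .inl (ml h4)⟩
  · exact ⟨not_le.1 h5, .inl (ml h4), .inr (.inr rfl)⟩
  · exact ⟨h, .inr (.inl rfl), .inr (.inr rfl)⟩

theorem iotaInvColumn_isExchange {n : ℕ} (x : Fin n → ℕ) (α β : Fin n) (h : α < β) :
    IsExchange x (α, β) (iotaInvColumn x α β) := by
  have ma : ∀ c (hc : (above x c).Nonempty),
      0 < x ((above x c).min' hc) ∧ c < (above x c).min' hc := fun c hc => by
    simpa [above] using (above x c).min'_mem hc
  have ml : ∀ (hc : (letters x).Nonempty), 0 < x ((letters x).min' hc) := fun hc => by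
    simpa [letters] using (letters x).min'_mem hc
  unfold iotaInvColumn IsExchange
  split_ifs with h1 h2 h3 h4 h5
  · exact ⟨h4, .inl (ma _ h2).1, .inl (ma _ h3).1⟩
  · refine ⟨lt_of_lt_of_le (ma _ h3).2 (not_lt.1 h4), .inr (.inr rfl), .inl (ma _ h2).1⟩
  · exact ⟨lt_of_le_of_lt h5 (ma _ h2).2, .inl (ml h1), .inl (ma _ h2).1⟩
  · exact ⟨not_le.1 h5, .inr (.inl rfl), .inl (ml h1)⟩
  · refine ⟨?_, .inl (ml h1), .inr (.inr rfl)⟩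
    refine lt_of_le_of_lt (not_lt.1 fun hc => h2 ?_) h
    exact ⟨_, by simpa [above] using ⟨ml h1, hc⟩⟩
  · exact ⟨h, .inr (.inl rfl), .inr (.inr rfl)⟩

/-- The number of times that the letter `k` appears in a column `d`. -/
def colCount {n : ℕ} (d : Fin n × Fin n) (k : Fin n) : ℕ :=
  (if k = d.1 then 1 else 0) + (if k = d.2 then 1 else 0)

/-- The row obtained from `x` by adding the letters of `d` and taking away those of `d'`. -/
def exchangeRow {n ℓ : ℕ} (x : Row n ℓ) (d d' : Fin n × Fin n) (h : IsExchange x.1 d d') :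
    Row n ℓ :=
  ⟨fun k => x.1 k + colCount d k - colCount d' k, by
    rw [sum_exchange, x.2]
    · simp [colCount, Finset.sum_add_distrib]
    · intro k
      obtain ⟨h1, h2, h3⟩ := h
      unfold colCount
      by_cases e1 : k = d'.1
      · have e2 : ¬ k = d'.2 := fun e => absurd (e1.symm.trans e) h1.ne
        rw [if_pos e1, if_neg e2]
        rw [← e1] at h2
        rcases h2 with h2 | h2 | h2
        · omega
        · rw [if_pos h2]; omega
        · rw [if_pos h2]; omega
      · by_cases e2 : k = d'.2
        · rw [if_neg e1, if_pos e2]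
          rw [← e2] at h3
          rcases h3 with h3 | h3 | h3
          · omega
          · rw [if_pos h3]; omega
          · rw [if_pos h3]; omega
        · rw [if_neg e1, if_neg e2]; omega⟩

/-- The map `ι'' : B_ℓ ⊗ B_♮ → B_♮ ⊗ B_ℓ`. -/
def iota (n ℓ : ℕ) (b : Row n ℓ × Domino n) : Domino n × Row n ℓ :=
  (⟨iotaColumn b.1.1 b.2.1.1 b.2.1.2, (iotaColumn_isExchange _ _ _ b.2.2).1⟩,
   exchangeRow b.1 b.2.1 _ (iotaColumn_isExchange _ _ _ b.2.2))

/-- The map `(ι'')⁻¹ : B_♮ ⊗ B_ℓ → B_ℓ ⊗ B_♮`. -/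
def iotaInv (n ℓ : ℕ) (b : Domino n × Row n ℓ) : Row n ℓ × Domino n :=
  (exchangeRow b.2 b.1.1 _ (iotaInvColumn_isExchange _ _ _ b.1.2),
   ⟨iotaInvColumn b.2.1 b.1.1.1 b.1.1.2, (iotaInvColumn_isExchange _ _ _ b.1.2).1⟩)

/-! ### The operators `σ_1`, `σ_2` on threefold tensor products -/

/-- The shapes `(ℓ)` and `(1,1)`. -/
inductive Shape where
  | row (ℓ : ℕ)
  | col

/-- The crystal `B_λ` for the shapes `(ℓ)` and `(1,1)`. -/
def Shape.crystal (n : ℕ) : Shape → Crystal n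
  | .row ℓ => rowCrystal n ℓ
  | .col => dominoCrystal n

/-- The map `σ` on a tensor product of two of these crystals: one of `R`, `ι''`, `(ι'')⁻¹`
(and the identity on `B_♮ ⊗ B_♮`). -/
def sigma (n : ℕ) [NeZero n] : (s t : Shape) →
    ((s.crystal n).tensor (t.crystal n)).carrier → ((t.crystal n).tensor (s.crystal n)).carrier
  | .row ℓ, .row m => R n ℓ m
  | .row ℓ, .col => iota n ℓ
  | .col, .row ℓ => iotaInv n ℓ
  | .col, .col => id

/-- `B_s ⊗ B_t ⊗ B_u` as a set. -/
abbrev Triple (n : ℕ) (s t u : Shape) : Type :=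
  ((s.crystal n).tensor ((t.crystal n).tensor (u.crystal n))).carrier

/-- `σ_1 (b_1 ⊗ b_2 ⊗ b_3) = σ (b_1 ⊗ b_2) ⊗ b_3`. -/
def sigma₁ {n : ℕ} [NeZero n] {s t u : Shape} (b : Triple n s t u) : Triple n t s u :=
  ((sigma n s t (b.1, b.2.1)).1, (sigma n s t (b.1, b.2.1)).2, b.2.2)

/-- `σ_2 (b_1 ⊗ b_2 ⊗ b_3) = b_1 ⊗ σ (b_2 ⊗ b_3)`. -/
def sigma₂ {n : ℕ} [NeZero n] {s t u : Shape} (b : Triple n s t u) : Triple n s u t :=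
  (b.1, sigma n t u b.2)

/-- The identity `σ_1 σ_2 σ_1 = σ_2 σ_1 σ_2` of maps on `B_s ⊗ B_t ⊗ B_u`. -/
def BraidRelation (n : ℕ) [NeZero n] (s t u : Shape) : Prop :=
  ∀ b : Triple n s t u, sigma₁ (sigma₂ (sigma₁ b)) = sigma₂ (sigma₁ (sigma₂ b))

end ColouredBBS

/-! All the crystals involved are normal: `φ_i` and `ε_i` measure the `i`-strings, and every element
is reached from a highest weight element by operators `f_i`. Hence two morphisms agree as soon as
they agree on highest weight elements (`Crystal.IsNormal.ext`), where few candidates of a given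
content exist.

That `R` and `ι''` commute with `f_i` is a local computation. Applying `f_i` moves one letter from
`i` to `i + 1`, and the tensor product rule is exactly the condition under which this changes no
`P_j` except possibly `P_{i+1}` (`R_shift`). For `ι''` the role of `P` is played by a carrier, a
0/1-valued function on the cyclically ordered letters that satisfies a max-recursion and replaces
the case lists in the definition (`iota_carry`); again only its value at `i + 1` can change
(`iota_shift`). The same carrier, read in the opposite direction, describes `(ι'')⁻¹`, so that
`(ι'')⁻¹ ∘ ι'' = id`; finiteness gives the other composite. The map `R` is an involution because
highest weight elements of a product of two rows are determined by their content.

For the braid relation on row, row, column, let `T` be the composite of six maps `σ` that is the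
identity exactly when the relation holds. It is an injective, content-preserving crystal
endomorphism. In a highest weight element the first row has only letters 1, the second only letters
1 and 2, and the column is (1,2), (1,3), (2,3) or (3,4). Content separates these elements except for
(1,3) against (2,3). For the column (1,3) the relation is checked directly (`braid_of_highest`), so
`T` fixes these elements; by injectivity no other element is sent to one of them, and content then
fixes the rest. The other two orders of the factors follow by conjugation with the involutive `σ`.
-/

namespace ColouredBBS

/-! ### Normal crystals, their morphisms and tensor products. -/

/-- The functions `φ_i` and `ε_i` are the lengths of the `i`-strings, and `w b k` is the number of
letters `k` in `b`. -/
structure Crystal.IsNormal {n : ℕ} (B : Crystal n) (w : B.carrier → Fin n → ℕ) : Prop where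
  phi_of_none : ∀ {i b}, B.f i b = none → B.phi i b = 0
  phi_f : ∀ {i b c}, B.f i b = some c → B.phi i b = B.phi i c + 1
  eps_f : ∀ {i b c}, B.f i b = some c → B.eps i c = B.eps i b + 1
  exists_f : ∀ {i c}, 0 < B.eps i c → ∃ b, B.f i b = some c
  content_f : ∀ {i b c}, B.f i b = some c → ∀ k,
    w c k + (if k = lo i then 1 else 0) = w b k + (if k = hi i then 1 else 0)
  phi_add : ∀ i b, B.phi i b + w b (hi i) = B.eps i b + w b (lo i)

theorem lo_ne_hi {n : ℕ} (i : Fin (n - 1)) : lo i ≠ hi i := by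
  simp [lo, hi, Fin.ext_iff]

theorem Crystal.tensor_f_left {n : ℕ} (B C : Crystal n) {i : Fin (n - 1)}
    {b b' : B.carrier} {c : C.carrier} (h : C.eps i c < B.phi i b) (hb : B.f i b = some b') :
    (B.tensor C).f i (b, c) = some (b', c) := by
  simp [Crystal.tensor, h, hb]

theorem Crystal.tensor_f_right {n : ℕ} (B C : Crystal n) {i : Fin (n - 1)}
    {b : B.carrier} {c c' : C.carrier} (h : B.phi i b ≤ C.eps i c) (hc : C.f i c = some c') :
    (B.tensor C).f i (b, c) = some (b, c') := by
  simp [Crystal.tensor, not_lt.2 h, hc]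

theorem Crystal.tensor_f_eq_some {n : ℕ} (B C : Crystal n) {i : Fin (n - 1)}
    {b b' : B.carrier} {c c' : C.carrier} (h : (B.tensor C).f i (b, c) = some (b', c')) :
    (C.eps i c < B.phi i b ∧ B.f i b = some b' ∧ c' = c) ∨
      (B.phi i b ≤ C.eps i c ∧ C.f i c = some c' ∧ b' = b) := by
  by_cases hlt : C.eps i c < B.phi i b
  · simp only [Crystal.tensor, hlt, if_true, Option.map_eq_some_iff, Prod.mk.injEq] at h
    obtain ⟨a, h1, h2, h3⟩ := h
    exact .inl ⟨hlt, h2 ▸ h1, h3.symm⟩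
  · simp only [Crystal.tensor, hlt, if_false, Option.map_eq_some_iff, Prod.mk.injEq] at h
    obtain ⟨a, h1, h2, h3⟩ := h
    exact .inr ⟨not_lt.1 hlt, h3 ▸ h1, h2.symm⟩

theorem Crystal.IsNormal.tensor {n : ℕ} {B C : Crystal n} {w : B.carrier → Fin n → ℕ}
    {v : C.carrier → Fin n → ℕ} (hB : B.IsNormal w) (hC : C.IsNormal v) :
    (B.tensor C).IsNormal (fun b k => w b.1 k + v b.2 k) where
  phi_of_none := by
    rintro i ⟨b, c⟩ h
    by_cases hlt : C.eps i c < B.phi i b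
    · simp only [Crystal.tensor, hlt, if_true, Option.map_eq_none_iff] at h
      have := hB.phi_of_none h
      omega
    · simp only [Crystal.tensor, hlt, if_false, Option.map_eq_none_iff] at h
      have := hC.phi_of_none h
      simp only [Crystal.tensor]
      omega
  phi_f := by
    rintro i ⟨b, c⟩ ⟨b', c'⟩ h
    rcases B.tensor_f_eq_some C h with ⟨h1, h2, rfl⟩ | ⟨h1, h2, rfl⟩
    · have := hB.phi_f h2
      simp only [Crystal.tensor]
      omega
    · have := hC.phi_f h2
      have := hC.eps_f h2
      simp only [Crystal.tensor]
      omega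
  eps_f := by
    rintro i ⟨b, c⟩ ⟨b', c'⟩ h
    rcases B.tensor_f_eq_some C h with ⟨h1, h2, rfl⟩ | ⟨h1, h2, rfl⟩
    · have := hB.phi_f h2
      have := hB.eps_f h2
      simp only [Crystal.tensor]
      omega
    · have := hC.eps_f h2
      simp only [Crystal.tensor]
      omega
  exists_f := by
    rintro i ⟨b, c⟩ h
    simp only [Crystal.tensor] at h
    by_cases hle : C.eps i c ≤ B.phi i b
    · obtain ⟨b', hb⟩ := hB.exists_f (i := i) (c := b) (by omega)
      have := hB.phi_f hb
      exact ⟨(b', c), B.tensor_f_left C (by omega) hb⟩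
    · obtain ⟨c', hc⟩ := hC.exists_f (i := i) (c := c) (by omega)
      have := hC.eps_f hc
      exact ⟨(b, c'), B.tensor_f_right C (by omega) hc⟩
  content_f := by
    rintro i ⟨b, c⟩ ⟨b', c'⟩ h k
    rcases B.tensor_f_eq_some C h with ⟨h1, h2, rfl⟩ | ⟨h1, h2, rfl⟩
    · have := hB.content_f h2 k
      simp only
      omega
    · have := hC.content_f h2 k
      simp only
      omega
  phi_add := by
    rintro i ⟨b, c⟩
    have h1 := hB.phi_add i b
    have h2 := hC.phi_add i c
    simp only [Crystal.tensor]
    omega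

/-- Highest weight elements. -/
def Crystal.IsHighest {n : ℕ} (B : Crystal n) (b : B.carrier) : Prop := ∀ i, B.eps i b = 0

/-- Maps that preserve `f_i`, `φ_i` and `ε_i`. -/
structure IsMorphism {n : ℕ} (B C : Crystal n) (g : B.carrier → C.carrier) : Prop where
  f : ∀ i b, C.f i (g b) = (B.f i b).map g
  phi : ∀ i b, C.phi i (g b) = B.phi i b
  eps : ∀ i b, C.eps i (g b) = B.eps i b

/-- Commuting with `f_i` transports `φ_i`, by induction along the `i`-string down to its end; `ε_i`
is then recovered from `φ_i` and the content, through `phi_add`. -/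
theorem Crystal.IsNormal.isMorphism {n : ℕ} {B C : Crystal n} {w : B.carrier → Fin n → ℕ}
    {v : C.carrier → Fin n → ℕ} (hB : B.IsNormal w) (hC : C.IsNormal v)
    {g : B.carrier → C.carrier} (hf : ∀ i b, C.f i (g b) = (B.f i b).map g)
    (hw : ∀ b, v (g b) = w b) : IsMorphism B C g := by
  have hphi : ∀ i m b, B.phi i b = m → C.phi i (g b) = m := by
    intro i m
    induction m with
    | zero =>
      intro b hb
      cases h : B.f i b with
      | none => exact hC.phi_of_none (by rw [hf, h]; rfl)
      | some c => have := hB.phi_f h; omega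
    | succ m ih =>
      intro b hb
      cases h : B.f i b with
      | none => have := hB.phi_of_none h; omega
      | some c =>
        have h1 := hB.phi_f h
        have h2 := hf i b
        rw [h, Option.map_some] at h2
        rw [hC.phi_f h2, ih c (by omega)]
  refine ⟨hf, fun i b => hphi i _ b rfl, fun i b => ?_⟩
  have h1 := hB.phi_add i b
  have h2 := hC.phi_add i (g b)
  rw [hw, hphi i _ b rfl] at h2
  omega

theorem IsMorphism.comp {n : ℕ} {B C D : Crystal n} {h : C.carrier → D.carrier}
    {g : B.carrier → C.carrier} (hh : IsMorphism C D h) (hg : IsMorphism B C g) :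
    IsMorphism B D (h ∘ g) where
  f i b := by rw [Function.comp_apply, hh.f, hg.f, Option.map_map]
  phi i b := by rw [Function.comp_apply, hh.phi, hg.phi]
  eps i b := by rw [Function.comp_apply, hh.eps, hg.eps]

theorem isMorphism_id {n : ℕ} (B : Crystal n) : IsMorphism B B id where
  f i b := by simp
  phi _ _ := rfl
  eps _ _ := rfl

theorem IsMorphism.isHighest {n : ℕ} {B C : Crystal n} {g : B.carrier → C.carrier}
    (hg : IsMorphism B C g) {b : B.carrier} (hb : B.IsHighest b) : C.IsHighest (g b) :=
  fun i => (hg.eps i b).trans (hb i)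

theorem IsMorphism.inverse {n : ℕ} {B C : Crystal n} {g : B.carrier → C.carrier}
    {h : C.carrier → B.carrier} (hg : IsMorphism B C g) (h1 : Function.LeftInverse h g)
    (h2 : Function.RightInverse h g) : IsMorphism C B h where
  f i c := by
    have := hg.f i (h c)
    rw [h2 c] at this
    rw [this, Option.map_map, h1.comp_eq_id, Option.map_id, id_eq]
  phi i c := by rw [← hg.phi, h2 c]
  eps i c := by rw [← hg.eps, h2 c]

/-- Morphisms are determined by their values on the highest weight elements. -/
theorem Crystal.IsNormal.ext {n : ℕ} {B C : Crystal n} {w : B.carrier → Fin n → ℕ}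
    (hB : B.IsNormal w) {g h : B.carrier → C.carrier} (hg : IsMorphism B C g)
    (hh : IsMorphism B C h) (H : ∀ b, B.IsHighest b → g b = h b) : g = h := by
  -- The weighted sum of the letters increases by one under each `f_i`. An element that is not of
  -- highest weight is `f_i c` for some `c` with a smaller sum, and its images are determined by
  -- those of `c`.
  have key : ∀ m b, ∑ k : Fin n, k.1 * w b k = m → g b = h b := by
    intro m
    induction m with
    | zero =>
      intro b hb
      refine H b fun i => ?_
      by_contra hne
      -- If `b = f_i c`, then `b` contains the letter `i + 1`, whose weight in the sum is positive,
      -- contrary to the sum being zero.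
      obtain ⟨c, hc⟩ := hB.exists_f (Nat.pos_of_ne_zero hne)
      have h1 := hB.content_f hc (hi i)
      rw [if_neg (lo_ne_hi i).symm, if_pos rfl] at h1
      have h2 := (Finset.sum_eq_zero_iff.1 hb) (hi i) (Finset.mem_univ _)
      simp only [hi, mul_eq_zero] at h2 h1
      omega
    | succ m ih =>
      intro b hb
      by_cases hh' : B.IsHighest b
      · exact H b hh'
      · obtain ⟨i, hi'⟩ := not_forall.1 hh'
        obtain ⟨c, hc⟩ := hB.exists_f (Nat.pos_of_ne_zero hi')
        have hs : ∑ k : Fin n, k.1 * w b k + lo i = ∑ k : Fin n, k.1 * w c k + hi i := by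
          have := Finset.sum_congr (rfl : (Finset.univ : Finset (Fin n)) = _)
            fun k _ => congrArg (k.1 * ·) (hB.content_f hc k)
          simpa [mul_add, Finset.sum_add_distrib] using this
        have hlh : (hi i : Fin n).1 = (lo i : Fin n).1 + 1 := rfl
        have h1 := hg.f i c
        have h2 := hh.f i c
        rw [hc, Option.map_some] at h1 h2
        rw [ih c (by omega), h2] at h1
        exact (Option.some.inj h1).symm
  exact funext fun b => key _ b rfl

theorem IsMorphism.tensor_id {n : ℕ} {B C : Crystal n} {g : B.carrier → C.carrier}
    (hg : IsMorphism B C g) (D : Crystal n) :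
    IsMorphism (B.tensor D) (C.tensor D) (fun b => (g b.1, b.2)) where
  f i b := by
    simp only [Crystal.tensor, hg.phi, hg.f]
    split_ifs <;> simp [Option.map_map, Function.comp_def]
  phi i b := by simp only [Crystal.tensor, hg.phi]
  eps i b := by simp only [Crystal.tensor, hg.phi, hg.eps]

theorem IsMorphism.id_tensor {n : ℕ} {B C : Crystal n} {g : B.carrier → C.carrier}
    (hg : IsMorphism B C g) (D : Crystal n) :
    IsMorphism (D.tensor B) (D.tensor C) (fun b => (b.1, g b.2)) where
  f i b := by
    simp only [Crystal.tensor, hg.eps, hg.f]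
    split_ifs <;> simp [Option.map_map, Function.comp_def]
  phi i b := by simp only [Crystal.tensor, hg.phi, hg.eps]
  eps i b := by simp only [Crystal.tensor, hg.eps]

/-- Both bracketings let `f_i` act on the same one of the three factors. This is needed because
threefold products are bracketed to the right, while `σ_1` acts on the first two factors. -/
theorem isMorphism_assoc {n : ℕ} (B C D : Crystal n) :
    IsMorphism ((B.tensor C).tensor D) (B.tensor (C.tensor D))
      (fun b => (b.1.1, b.1.2, b.2)) where
  f i b := by
    obtain ⟨⟨b, c⟩, d⟩ := b
    simp only [Crystal.tensor]
    by_cases h1 : C.eps i c < B.phi i b <;> by_cases h2 : D.eps i d < C.phi i c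
    · rw [if_pos (by omega), if_pos (by omega), if_pos h1]
      simp [Option.map_map, Function.comp_def]
    · by_cases h3 : C.eps i c + D.eps i d - C.phi i c < B.phi i b
      · rw [if_pos (by omega), if_pos (by omega), if_pos h1]
        simp [Option.map_map, Function.comp_def]
      · rw [if_neg (by omega), if_neg (by omega), if_neg (by omega)]
        simp [Option.map_map, Function.comp_def]
    · rw [if_neg (by omega), if_pos (by omega), if_pos (by omega), if_neg h1]
      simp [Option.map_map, Function.comp_def]
    · rw [if_neg (by omega), if_neg (by omega), if_neg (by omega)]
      simp [Option.map_map, Function.comp_def]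
  phi i b := by
    simp only [Crystal.tensor]
    omega
  eps i b := by
    simp only [Crystal.tensor]
    omega

theorem IsMorphism.tensor_left {n : ℕ} {B C B' C' : Crystal n}
    {g : (B.tensor C).carrier → (B'.tensor C').carrier}
    (hg : IsMorphism (B.tensor C) (B'.tensor C') g) (D : Crystal n) :
    IsMorphism (B.tensor (C.tensor D)) (B'.tensor (C'.tensor D))
      (fun b => ((g (b.1, b.2.1)).1, (g (b.1, b.2.1)).2, b.2.2)) :=
  ((isMorphism_assoc B' C' D).comp ((hg.tensor_id D).comp
    ((isMorphism_assoc B C D).inverse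
      (h := fun b : B.carrier × C.carrier × D.carrier => ((b.1, b.2.1), b.2.2))
      (fun _ => rfl) (fun _ => rfl))) :)

/-! ### Rows and columns as normal crystals, described by letter multiplicities. -/

theorem rowCrystal_isNormal (n ℓ : ℕ) : (rowCrystal n ℓ).IsNormal (fun x => x.1) where
  phi_of_none := by
    intro i x h
    simp only [rowCrystal, rowF] at h ⊢
    split_ifs at h with h1
    omega
  phi_f := by
    intro i x y h
    simp only [rowCrystal, rowF] at h ⊢
    split_ifs at h with h1
    obtain rfl := Option.some.inj h
    simp only [if_neg (lo_ne_hi i), if_true]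
    omega
  eps_f := by
    intro i x y h
    simp only [rowCrystal, rowF] at h ⊢
    split_ifs at h with h1
    obtain rfl := Option.some.inj h
    simp only [if_neg (lo_ne_hi i).symm, if_true]
    omega
  exists_f := by
    intro i x h
    simp only [rowCrystal] at h
    refine ⟨⟨fun k => x.1 k + (if k = lo i then 1 else 0) - (if k = hi i then 1 else 0), ?_⟩, ?_⟩
    · rw [sum_exchange, x.2]
      · simp
      · intro k
        by_cases hk : k = hi i
        · subst hk; simp only [if_true]; omega
        · simp [hk]
    · simp only [rowCrystal, rowF, if_neg (lo_ne_hi i), if_true]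
      rw [dif_pos (by omega)]
      congr 1
      apply Subtype.ext
      funext k
      have := lo_ne_hi i
      by_cases h1 : k = lo i
      · subst h1; simp [lo_ne_hi]
      · by_cases h2 : k = hi i
        · subst h2; simp [h1]; omega
        · simp [h1, h2]
  content_f := by
    intro i x y h k
    simp only [rowCrystal, rowF] at h ⊢
    split_ifs at h with h1
    obtain rfl := Option.some.inj h
    by_cases h2 : k = lo i
    · subst h2; simp only [if_true]; omega
    · simp [h2]
  phi_add _ _ := Nat.add_comm _ _

theorem colCount_eq {n : ℕ} (d : Domino n) (k : Fin n) :
    colCount d.1 k = if d.Has k then 1 else 0 := by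
  have := d.2.ne
  unfold colCount Domino.Has
  by_cases h1 : k = d.1.1
  · have : ¬ k = d.1.2 := fun h => this (h1.symm.trans h)
    simp [h1, d.2.ne]
  · simp [h1]

theorem colCount_pos_iff {n : ℕ} (d : Domino n) (k : Fin n) : 0 < colCount d.1 k ↔ d.Has k := by
  rw [colCount_eq]
  split_ifs with h <;> simp [h]

theorem colCount_le_one {n : ℕ} (d : Domino n) (k : Fin n) : colCount d.1 k ≤ 1 := by
  rw [colCount_eq]
  split_ifs <;> omega

theorem Domino.ext_of_colCount {n : ℕ} {d e : Domino n}
    (h : ∀ k, colCount d.1 k = colCount e.1 k) : d = e := by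
  have h' : ∀ k, d.Has k ↔ e.Has k := fun k => by rw [← colCount_pos_iff, h, colCount_pos_iff]
  obtain ⟨⟨a, b⟩, hab⟩ := d
  obtain ⟨⟨a', b'⟩, hab'⟩ := e
  have hlt : a.1 < b.1 := hab
  have hlt' : a'.1 < b'.1 := hab'
  have hk : ∀ k, (k = a ∨ k = b) ↔ (k = a' ∨ k = b') := h'
  have e1 := (hk a).1 (.inl rfl)
  have e2 := (hk b).1 (.inr rfl)
  have e3 := (hk a').2 (.inl rfl)
  have e4 := (hk b').2 (.inr rfl)
  simp only [Fin.ext_iff] at e1 e2 e3 e4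
  apply Subtype.ext
  apply Prod.ext <;> simp only [Fin.ext_iff] <;> omega

theorem colCount_swap {n : ℕ} {i j : Fin n} {d : Domino n} (hi : d.Has i)
    (hj : ¬ d.Has j) (k : Fin n) :
    colCount (if d.1.1 = i then j else d.1.1, if d.1.2 = i then j else d.1.2) k
      + (if k = i then 1 else 0) = colCount d.1 k + (if k = j then 1 else 0) := by
  obtain ⟨⟨a, b⟩, hab⟩ := d
  have hab' : a ≠ b := hab.ne
  simp only [Domino.Has, not_or] at hi hj
  simp only [colCount]
  rcases hi with rfl | rfl
  · rw [if_pos rfl, if_neg hab'.symm]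
    omega
  · rw [if_pos rfl, if_neg hab']
    omega

theorem colCount_dominoF {n : ℕ} {i : Fin (n - 1)} {d e : Domino n} (h : dominoF i d = some e)
    (k : Fin n) :
    colCount e.1 k + (if k = lo i then 1 else 0) = colCount d.1 k + (if k = hi i then 1 else 0) := by
  by_cases h1 : d.Has (lo i) ∧ ¬ d.Has (hi i)
  · rw [dominoF, dif_pos h1] at h
    obtain rfl := Option.some.inj h
    exact colCount_swap h1.1 h1.2 k
  · rw [dominoF, dif_neg h1] at h
    exact absurd h (by simp)

/-- Multiplicities in a column are at most one, so a unit can leave `i` and arrive at `j` only if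
`i` was present and `j` absent. -/
theorem has_of_colCount_shift {n : ℕ} {i j : Fin n} (hij : i ≠ j) {d e : Domino n} (h : ∀ k,
    colCount e.1 k + (if k = i then 1 else 0) = colCount d.1 k + (if k = j then 1 else 0)) :
    (d.Has i ∧ ¬ d.Has j) ∧ (e.Has j ∧ ¬ e.Has i) := by
  have h1 := h i
  have h2 := h j
  rw [if_pos rfl, if_neg hij] at h1
  rw [if_pos rfl, if_neg hij.symm] at h2
  have := colCount_le_one d i
  have := colCount_le_one e j
  simp only [← colCount_pos_iff]
  omega

/-- The map `f_i` on columns, in terms of the numbers of letters. -/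
theorem dominoF_eq_some {n : ℕ} {i : Fin (n - 1)} {d e : Domino n} (h : ∀ k,
    colCount e.1 k + (if k = lo i then 1 else 0) = colCount d.1 k + (if k = hi i then 1 else 0)) :
    dominoF i d = some e := by
  have hd := (has_of_colCount_shift (lo_ne_hi i) h).1
  cases hf : dominoF i d with
  | none => simp [dominoF, hd] at hf
  | some e' =>
    congr 1
    refine Domino.ext_of_colCount fun k => ?_
    have := colCount_dominoF hf k
    have := h k
    omega

theorem dominoCrystal_phi {n : ℕ} (i : Fin (n - 1)) (d : Domino n) :
    (dominoCrystal n).phi i d = colCount d.1 (lo i) - colCount d.1 (hi i) := by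
  simp only [dominoCrystal, colCount_eq]
  split_ifs <;> first | rfl | tauto

theorem dominoCrystal_eps {n : ℕ} (i : Fin (n - 1)) (d : Domino n) :
    (dominoCrystal n).eps i d = colCount d.1 (hi i) - colCount d.1 (lo i) := by
  simp only [dominoCrystal, colCount_eq]
  split_ifs <;> first | rfl | tauto

theorem dominoCrystal_isNormal (n : ℕ) :
    (dominoCrystal n).IsNormal (fun d k => colCount d.1 k) where
  phi_of_none := by
    intro i d h
    simp only [dominoCrystal, dominoF] at h ⊢
    split_ifs at h with h1
    rw [if_neg h1]
  phi_f := by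
    intro i d e h
    have := has_of_colCount_shift (lo_ne_hi i) (colCount_dominoF h)
    simp [dominoCrystal, this]
  eps_f := by
    intro i d e h
    have := has_of_colCount_shift (lo_ne_hi i) (colCount_dominoF h)
    simp [dominoCrystal, this]
  exists_f := by
    intro i d h
    have h1 : d.Has (hi i) ∧ ¬ d.Has (lo i) := by
      by_contra hc
      simp [dominoCrystal, hc] at h
    refine ⟨⟨(if d.1.1 = hi i then lo i else d.1.1, if d.1.2 = hi i then lo i else d.1.2), ?_⟩,
      dominoF_eq_some fun k => (colCount_swap h1.1 h1.2 k).symm⟩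
    obtain ⟨⟨a, b⟩, hab⟩ := d
    clear h
    simp only [Domino.Has, lo, hi, Fin.ext_iff, Fin.lt_def] at h1 hab ⊢
    split_ifs <;> simp_all <;> omega
  content_f := colCount_dominoF
  phi_add i d := by
    have h1 := dominoCrystal_phi i d
    have h2 := dominoCrystal_eps i d
    revert h1 h2
    generalize (dominoCrystal n).phi i d = p
    generalize (dominoCrystal n).eps i d = e
    intro h1 h2
    change p + colCount (Subtype.val d) _ = e + colCount (Subtype.val d) _
    omega

theorem rowF_eq_some {n ℓ : ℕ} {i : Fin (n - 1)} {x y : Row n ℓ} (h : ∀ k,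
    y.1 k + (if k = lo i then 1 else 0) = x.1 k + (if k = hi i then 1 else 0)) :
    rowF i x = some y := by
  have h1 := h (lo i)
  rw [if_pos rfl, if_neg (lo_ne_hi i)] at h1
  rw [rowF, dif_pos (by omega)]
  congr 1
  apply Subtype.ext
  funext k
  have := h k
  simp only
  omega

/-! ### The map `R` commutes with the crystal operators and is involutive. -/

theorem lo_add_one {n : ℕ} [NeZero n] (i : Fin (n - 1)) : (lo i : Fin n) + 1 = hi i := by
  have := i.2
  apply Fin.ext
  rw [Fin.val_add, Fin.val_one', Nat.add_mod_mod]
  exact Nat.mod_eq_of_lt (hi i).2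

theorem P_le_iff {n : ℕ} [NeZero n] (x y : Fin n → ℕ) (i : Fin n) (v : ℤ) :
    P x y i ≤ v ↔ ∀ j < n, term x y i j ≤ v := by
  simp [P, Finset.sup'_le_iff]

theorem term_succ_right {n : ℕ} [NeZero n] (x y : Fin n → ℕ) (i : Fin n) (j : ℕ) :
    term x y i (j + 1) =
      term x y i j - x (i + Fin.ofNat n j) + y (i + Fin.ofNat n (j + 1)) := by
  unfold term
  rw [Finset.sum_range_succ]
  ring

theorem add_ofNat_eq_iff {n : ℕ} [NeZero n] (i j : Fin n) {k : ℕ} (hk : k < n) :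
    j + Fin.ofNat n k = i ↔ k = (i - j).1 := by
  have h : Fin.ofNat n k = i - j ↔ k = (i - j).1 := by
    rw [Fin.ext_iff, Fin.val_ofNat, Nat.mod_eq_of_lt hk]
  rw [← h, eq_sub_iff_add_eq, add_comm]

theorem sub_val_add_one_lt {n : ℕ} [NeZero n] {i j : Fin n} (h : j ≠ i + 1) :
    (i - j).1 + 1 < n := by
  by_contra hc
  have h1 := (i - j).2
  have h2 : (i - j).1 + 1 = n := by omega
  have h3 : i - j + 1 = 0 := by
    apply Fin.ext
    rw [Fin.val_add, Fin.val_one', Nat.add_mod_mod, h2, Nat.mod_self]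
    rfl
  apply h
  have h4 : i + 1 - j = 0 := by rw [← h3]; abel
  exact (sub_eq_zero.1 h4).symm

theorem sub_val_add_one {n : ℕ} [NeZero n] {i j : Fin n} (h : j ≠ i + 1) :
    (i + 1 - j).1 = (i - j).1 + 1 := by
  have h1 : i + 1 - j = i - j + 1 := by abel
  rw [h1, Fin.val_add, Fin.val_one', Nat.add_mod_mod, Nat.mod_eq_of_lt (sub_val_add_one_lt h)]

/-- Moving letters from `i` to `i + 1` changes only `P_{i+1}`, if it preserves the maximum of
the expressions in `P_i` that end at `i` and `i + 1`. -/
theorem P_le_of_shift {n : ℕ} [NeZero n] {x y x' y' : Fin n → ℕ} {i : Fin n} {u v : ℤ}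
    (hx : ∀ k, (x' k : ℤ) = x k + u * ((if k = i + 1 then 1 else 0) - (if k = i then 1 else 0)))
    (hy : ∀ k, (y' k : ℤ) = y k + v * ((if k = i + 1 then 1 else 0) - (if k = i then 1 else 0)))
    (hmax : max (y' i : ℤ) (y' i - x' i + y' (i + 1)) ≤ max (y i : ℤ) (y i - x i + y (i + 1)))
    (hne : i ≠ i + 1) {j : Fin n} (hj : j ≠ i + 1) : P x' y' j ≤ P x y j := by
  have hm := sub_val_add_one_lt hj
  have hm' := sub_val_add_one hj
  -- Here `m` is the offset of `i` in the cyclic window that starts at `j`. Since `j ≠ i + 1`, the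
  -- window meets `i + 1` immediately afterwards, at offset `m + 1`.
  set m := (i - j).1 with hmdef
  have hi0 : j + Fin.ofNat n m = i := (add_ofNat_eq_iff _ _ (by omega)).2 rfl
  have hi1 : j + Fin.ofNat n (m + 1) = i + 1 := (add_ofNat_eq_iff _ _ (by omega)).2 hm'.symm
  -- A partial sum is affected only if it contains `i` but not `i + 1`, that is for `r = m + 1`.
  -- Together with the final summand, only the expressions ending at `i` and `i + 1` can change, and
  -- `hmax` controls their maximum.
  have hS : ∀ r < n, ∑ k ∈ Finset.range r,
        ((y' (j + Fin.ofNat n k) : ℤ) - x' (j + Fin.ofNat n k)) =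
      ∑ k ∈ Finset.range r, ((y (j + Fin.ofNat n k) : ℤ) - x (j + Fin.ofNat n k))
        + (v - u) * ((if m + 1 < r then 1 else 0) - (if m < r then 1 else 0)) := by
    intro r hr
    have h1 : ∀ k ∈ Finset.range r,
        ((y' (j + Fin.ofNat n k) : ℤ) - x' (j + Fin.ofNat n k)) =
        ((y (j + Fin.ofNat n k) : ℤ) - x (j + Fin.ofNat n k)) +
          (v - u) * ((if k = m + 1 then 1 else 0) - (if k = m then 1 else 0)) := by
      intro k hk
      rw [Finset.mem_range] at hk
      rw [hx, hy]
      simp only [add_ofNat_eq_iff _ _ (lt_trans hk hr), hm', ← hmdef]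
      ring
    rw [Finset.sum_congr rfl h1, Finset.sum_add_distrib, ← Finset.mul_sum]
    simp only [Finset.sum_sub_distrib, Finset.sum_ite_eq', Finset.mem_range]
  rw [P_le_iff]
  intro r hr
  have hT : ∀ r, term x y j r = ∑ k ∈ Finset.range r,
      ((y (j + Fin.ofNat n k) : ℤ) - x (j + Fin.ofNat n k)) + y (j + Fin.ofNat n r) := fun _ => rfl
  have hT' : term x' y' j r = ∑ k ∈ Finset.range r,
      ((y' (j + Fin.ofNat n k) : ℤ) - x' (j + Fin.ofNat n k)) + y' (j + Fin.ofNat n r) := rfl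
  have t0 := term_le_P x y j (j := m) (by omega)
  have t1 := term_le_P x y j (j := m + 1) (by omega)
  have t2 := term_le_P x y j hr
  rw [hT, hi0] at t0
  rw [hT, Finset.sum_range_succ, hi0, hi1] at t1
  rw [hT] at t2
  rw [hT', hS r hr]
  rcases lt_trichotomy r m with h | h | h
  · rw [if_neg (by omega), if_neg (by omega), hy, if_neg, if_neg]
    · simpa using t2
    · rw [add_ofNat_eq_iff _ _ hr, ← hmdef]; omega
    · rw [add_ofNat_eq_iff _ _ hr, hm']; omega
  · subst h
    rw [if_neg (by omega), if_neg (by omega), hi0]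
    omega
  · by_cases h' : r = m + 1
    · subst h'
      have hxi := hx i
      have hyi := hy i
      rw [if_neg hne, if_pos rfl] at hxi hyi
      rw [if_neg (by omega), if_pos (by omega), Finset.sum_range_succ, hi0, hi1]
      have : (v - u) * (0 - 1) = u - v := by ring
      have : u * (0 - 1) = - u := by ring
      have : v * (0 - 1) = - v := by ring
      omega
    · rw [if_pos (by omega), if_pos (by omega), hy, if_neg, if_neg]
      · simpa using t2
      · rw [add_ofNat_eq_iff _ _ hr, ← hmdef]; omega
      · rw [add_ofNat_eq_iff _ _ hr, hm']; omega

/-- The opposite inequality is the same statement for the reverse shift, with `-u` and `-v`. -/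
theorem P_eq_of_shift {n : ℕ} [NeZero n] {x y x' y' : Fin n → ℕ} {i : Fin n} {u v : ℤ}
    (hx : ∀ k, (x' k : ℤ) = x k + u * ((if k = i + 1 then 1 else 0) - (if k = i then 1 else 0)))
    (hy : ∀ k, (y' k : ℤ) = y k + v * ((if k = i + 1 then 1 else 0) - (if k = i then 1 else 0)))
    (hmax : max (y' i : ℤ) (y' i - x' i + y' (i + 1)) = max (y i : ℤ) (y i - x i + y (i + 1)))
    (hne : i ≠ i + 1) {j : Fin n} (hj : j ≠ i + 1) : P x' y' j = P x y j :=
  le_antisymm (P_le_of_shift hx hy hmax.le hne hj)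
    (P_le_of_shift (u := -u) (v := -v) (fun k => by rw [hx]; ring) (fun k => by rw [hy]; ring)
      hmax.ge hne hj)

/-- The values `P_i`, `P_{i+1}`, `P_{i+2}` in terms of a common part `N`. -/
theorem P_local {m : ℕ} (x y : Fin (m + 2) → ℕ) (i : Fin (m + 2)) {N : ℤ}
    (hN : 0 < m → ∀ v, N ≤ v ↔ ∀ j < m, term x y (i + 1 + 1) j ≤ v)
    (hN0 : m = 0 → N ≤ x (i + 1) ∧ N ≤ term x y (i + 1 + 1) m) :
    P x y i = max (y i : ℤ) (y i - x i + y (i + 1) + max 0 (N - x (i + 1))) ∧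
    P x y (i + 1) = y (i + 1) + max 0 (max N (term x y (i + 1 + 1) m) - x (i + 1)) ∧
    P x y (i + 1 + 1) =
      max N (max (term x y (i + 1 + 1) m) (term x y (i + 1 + 1) m - x i + y (i + 1))) := by
  -- The window from `i + 2` wraps around: its offset `m` is the letter `i` and its last offset `m +
  -- 1` is the letter `i + 1`.
  have hlast : term x y (i + 1 + 1) (m + 1) = term x y (i + 1 + 1) m - x i + y (i + 1) := by
    rw [term_succ_right, ← ofNat_succ_aux, ← ofNat_succ_aux, ← ofNat_succ_aux, ← ofNat_succ_aux]
    have h1 : Fin.ofNat (m + 2) (m + 1 + 1) = 0 := by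
      apply Fin.ext; simp
    have h2 : Fin.ofNat (m + 2) (m + 1 + 1 + 1) = 1 := by
      apply Fin.ext
      rw [Fin.val_ofNat, show m + 1 + 1 + 1 = 1 + (m + 2) by ring, Nat.add_mod_right]
      simp
    rw [h1, h2, add_zero]
  set t := term x y (i + 1 + 1) m with ht
  -- Each maximum is identified through its set of upper bounds, after splitting off the expressions
  -- that end at `i` or `i + 1`.
  have e2 : ∀ v, P x y (i + 1 + 1) ≤ v ↔
      (∀ j < m, term x y (i + 1 + 1) j ≤ v) ∧ t ≤ v ∧ t - x i + y (i + 1) ≤ v := by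
    intro v
    rw [P_le_iff, Nat.forall_lt_succ_right, Nat.forall_lt_succ_right, hlast, and_assoc]
  have e1 : ∀ v, P x y (i + 1) ≤ v ↔
      (y (i + 1) : ℤ) ≤ v ∧ (∀ j < m, term x y (i + 1 + 1) j ≤ v - (y (i + 1) - x (i + 1))) ∧
        t ≤ v - (y (i + 1) - x (i + 1)) := by
    intro v
    rw [P_le_iff, Nat.forall_lt_succ_left, term_zero, Nat.forall_lt_succ_right]
    simp only [term_succ x y (i + 1), le_sub_iff_add_le', ← ht]
  have e0 : ∀ v, P x y i ≤ v ↔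
      (y i : ℤ) ≤ v ∧ (y i : ℤ) - x i + y (i + 1) ≤ v ∧ (∀ j < m, term x y (i + 1 + 1) j ≤
        v - (y i - x i + (y (i + 1) - x (i + 1)))) := by
    intro v
    rw [P_le_iff, Nat.forall_lt_succ_left, term_zero, Nat.forall_lt_succ_left]
    simp only [term_succ, term_zero]
    refine and_congr Iff.rfl (and_congr ?_ (forall₂_congr fun j _ => ?_)) <;> omega
  -- For `m = 0` there are no letters besides `i` and `i + 1`, so `N` would be the maximum of an
  -- empty family. Any `N` small enough to be absorbed by the other entries of the maxima serves
  -- instead.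
  rcases Nat.eq_zero_or_pos m with hm | hm
  · obtain ⟨h1, h2⟩ := hN0 hm
    have hF : ∀ v, (∀ j < m, term x y (i + 1 + 1) j ≤ v) ↔ True :=
      fun v => iff_true_intro fun j hj => by omega
    refine ⟨eq_of_forall_ge_iff fun v => ?_, eq_of_forall_ge_iff fun v => ?_,
      eq_of_forall_ge_iff fun v => ?_⟩
    · rw [e0, hF, and_true]; omega
    · rw [e1, hF, true_and]; omega
    · rw [e2, hF, true_and]; omega
  · have hF := hN hm
    refine ⟨eq_of_forall_ge_iff fun v => ?_, eq_of_forall_ge_iff fun v => ?_,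
      eq_of_forall_ge_iff fun v => ?_⟩
    · rw [e0, ← hF]; omega
    · rw [e1, ← hF]; omega
    · rw [e2, ← hF]; omega

/-- `term x y i j` does not depend on the values outside the letters `i, …, i + j`. -/
theorem term_congr {n : ℕ} [NeZero n] {x y x' y' : Fin n → ℕ} {i : Fin n} {j : ℕ}
    (hx : ∀ k < j, x' (i + Fin.ofNat n k) = x (i + Fin.ofNat n k))
    (hy : ∀ k ≤ j, y' (i + Fin.ofNat n k) = y (i + Fin.ofNat n k)) :
    term x' y' i j = term x y i j := by
  unfold term
  rw [hy j le_rfl]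
  congr 1
  refine Finset.sum_congr rfl fun k hk => ?_
  rw [Finset.mem_range] at hk
  rw [hx k hk, hy k hk.le]

/-- `P_local` for two pairs of functions that differ only at `i` and `i + 1`. -/
theorem exists_P_local {m : ℕ} {x y x' y' : Fin (m + 2) → ℕ} {i : Fin (m + 2)}
    (hx : ∀ k, k ≠ i → k ≠ i + 1 → x' k = x k) (hy : ∀ k, k ≠ i → k ≠ i + 1 → y' k = y k) :
    ∃ N t : ℤ,
      (P x y i = max (y i : ℤ) (y i - x i + y (i + 1) + max 0 (N - x (i + 1))) ∧
        P x y (i + 1) = y (i + 1) + max 0 (max N t - x (i + 1)) ∧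
        P x y (i + 1 + 1) = max N (max t (t - x i + y (i + 1)))) ∧
      P x' y' (i + 1) = y' (i + 1) + max 0 (max N (t - y i + y' i) - x' (i + 1)) := by
  have hne : ∀ {k}, k < m → i + 1 + 1 + Fin.ofNat (m + 2) k ≠ i ∧
      i + 1 + 1 + Fin.ofNat (m + 2) k ≠ i + 1 := by
    intro k hk
    have e : ∀ r, i + 1 + 1 + Fin.ofNat (m + 2) r = i + Fin.ofNat (m + 2) (r + 2) := fun r => by
      rw [ofNat_succ_aux, ofNat_succ_aux]
    have e1 : i + 1 = i + Fin.ofNat (m + 2) 1 := by rw [ofNat_succ_aux]; simp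
    rw [e, e1]
    constructor
    · intro h
      rw [add_ofNat_eq_iff _ _ (by omega)] at h
      simp at h
    · intro h
      have := congrArg Fin.val (add_left_cancel h)
      rw [Fin.val_ofNat, Fin.val_ofNat, Nat.mod_eq_of_lt (by omega),
        Nat.mod_eq_of_lt (by omega)] at this
      omega
  have hterm : ∀ j < m, term x' y' (i + 1 + 1) j = term x y (i + 1 + 1) j := fun j hj =>
    term_congr (fun k hk => hx _ (hne (by omega)).1 (hne (by omega)).2)
      (fun k hk => hy _ (hne (by omega)).1 (hne (by omega)).2)
  have hi0 : i + 1 + 1 + Fin.ofNat (m + 2) m = i := by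
    rw [← ofNat_succ_aux, ← ofNat_succ_aux]
    have : Fin.ofNat (m + 2) (m + 1 + 1) = 0 := by apply Fin.ext; simp
    rw [this, add_zero]
  have ht : term x' y' (i + 1 + 1) m = term x y (i + 1 + 1) m - y i + y' i := by
    have h : ∀ k ∈ Finset.range m, (y' (i + 1 + 1 + Fin.ofNat (m + 2) k) : ℤ) -
        x' (i + 1 + 1 + Fin.ofNat (m + 2) k) =
        y (i + 1 + 1 + Fin.ofNat (m + 2) k) - x (i + 1 + 1 + Fin.ofNat (m + 2) k) := by
      intro k hk
      rw [Finset.mem_range] at hk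
      rw [hx _ (hne hk).1 (hne hk).2, hy _ (hne hk).1 (hne hk).2]
    unfold term
    rw [hi0, Finset.sum_congr rfl h]
    omega
  rcases Nat.eq_zero_or_pos m with hm | hm
  -- One value `N` has to be negligible for both pairs of functions at once, hence the minimum of
  -- all four bounds.
  · obtain ⟨N, h1, h2, h3, h4⟩ : ∃ N : ℤ, N ≤ x (i + 1) ∧ N ≤ x' (i + 1) ∧
        N ≤ term x y (i + 1 + 1) m ∧ N ≤ term x' y' (i + 1 + 1) m :=
      ⟨min (min (x (i + 1)) (x' (i + 1)))
        (min (term x y (i + 1 + 1) m) (term x' y' (i + 1 + 1) m)), by omega⟩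
    refine ⟨N, _, P_local x y i (fun h => by omega) (fun _ => ⟨h1, h3⟩), ?_⟩
    rw [← ht]
    exact (P_local x' y' i (fun h => by omega) (fun _ => ⟨h2, h4⟩)).2.1
  · obtain ⟨N, hN⟩ : ∃ N : ℤ, ∀ v, N ≤ v ↔ ∀ j < m, term x y (i + 1 + 1) j ≤ v :=
      ⟨(Finset.range m).sup' (Finset.nonempty_range_iff.2 hm.ne') (term x y (i + 1 + 1)),
        fun v => by simp [Finset.sup'_le_iff]⟩
    refine ⟨N, _, P_local x y i (fun _ => hN) (fun h => by omega), ?_⟩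
    rw [← ht]
    refine (P_local x' y' i (fun _ v => ?_) (fun h => by omega)).2.1
    rw [hN]
    exact forall₂_congr fun j hj => by rw [hterm j hj]

theorem R_fst_apply {n ℓ m : ℕ} [NeZero n] (x : Row n ℓ) (y : Row n m) (k : Fin n) :
    (((R n ℓ m (x, y)).1.1 k : ℕ) : ℤ) = y.1 k + P x.1 y.1 (k + 1) - P x.1 y.1 k :=
  Int.toNat_of_nonneg (R_fst_nonneg x.1 y.1 k)

theorem R_snd_apply {n ℓ m : ℕ} [NeZero n] (x : Row n ℓ) (y : Row n m) (k : Fin n) :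
    (((R n ℓ m (x, y)).2.1 k : ℕ) : ℤ) = x.1 k + P x.1 y.1 k - P x.1 y.1 (k + 1) :=
  Int.toNat_of_nonneg (R_snd_nonneg x.1 y.1 k)

theorem R_content {n ℓ m : ℕ} [NeZero n] (b : Row n ℓ × Row n m) (k : Fin n) :
    (R n ℓ m b).1.1 k + (R n ℓ m b).2.1 k = b.1.1 k + b.2.1 k := by
  obtain ⟨x, y⟩ := b
  have h1 := R_fst_apply x y k
  have h2 := R_snd_apply x y k
  change _ = x.1 k + y.1 k
  omega

/-- The effect of `f_i` on the tensor product of two rows is that of `f_i` on the image under `R`,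
in terms of the numbers of letters: here `u = 1` or `v = 1` according to the factor on which `f_i`
acts, and `w` is the change of `P_{i+1}`. -/
theorem R_shift {m : ℕ} {x y x' y' : Fin (m + 2) → ℕ} {i : Fin (m + 2)} {u v : ℤ}
    (hx : ∀ k, (x' k : ℤ) = x k + u * ((if k = i + 1 then 1 else 0) - (if k = i then 1 else 0)))
    (hy : ∀ k, (y' k : ℤ) = y k + v * ((if k = i + 1 then 1 else 0) - (if k = i then 1 else 0)))
    (huv : (u = 1 ∧ v = 0 ∧ y (i + 1) < x i) ∨ (u = 0 ∧ v = 1 ∧ x i ≤ y (i + 1))) :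
    ∃ w : ℤ, (∀ k, (y' k + P x' y' (k + 1) - P x' y' k : ℤ) = y k + P x y (k + 1) - P x y k +
        (v - w) * ((if k = i + 1 then 1 else 0) - (if k = i then 1 else 0))) ∧
      (∀ k, (x' k + P x' y' k - P x' y' (k + 1) : ℤ) = x k + P x y k - P x y (k + 1) +
        (u + w) * ((if k = i + 1 then 1 else 0) - (if k = i then 1 else 0))) ∧
      ((u + w = 0 ∧ v - w = 1 ∧ x (i + 1) + P x y (i + 1) - P x y (i + 1 + 1) <
          y i + P x y (i + 1) - P x y i) ∨
        (u + w = 1 ∧ v - w = 0 ∧ y i + P x y (i + 1) - P x y i ≤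
          x (i + 1) + P x y (i + 1) - P x y (i + 1 + 1))) := by
  have hne : i ≠ i + 1 := by simp
  obtain ⟨N, t, ⟨h1, h2, h3⟩, h4⟩ := exists_P_local (x := x) (y := y) (x' := x') (y' := y') (i := i)
    (fun k hk hk' => by have := hx k; simp [hk, hk'] at this; exact this)
    (fun k hk hk' => by have := hy k; simp [hk, hk'] at this; exact this)
  have hx0 := hx i
  have hx1 := hx (i + 1)
  have hy0 := hy i
  have hy1 := hy (i + 1)
  rw [if_neg hne, if_pos rfl] at hx0 hy0
  rw [if_neg hne.symm, if_pos rfl] at hx1 hy1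
  -- The tensor product rule enters here. If `y (i + 1) < x i`, the maximum of `y i` and `y i - x i
  -- + y (i + 1)` is the first entry before and after lowering `x i`; otherwise it is the second, in
  -- which the two changes of `y` cancel.
  have hP : ∀ j, j ≠ i + 1 → P x' y' j = P x y j := fun j hj =>
    P_eq_of_shift hx hy (by rcases huv with ⟨rfl, rfl, h⟩ | ⟨rfl, rfl, h⟩ <;> omega) hne hj
  have hP' : ∀ j, P x' y' j = P x y j + (P x' y' (i + 1) - P x y (i + 1)) *
      (if j = i + 1 then 1 else 0) := by
    intro j
    by_cases hj : j = i + 1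
    · subst hj; simp
    · simp [hj, hP]
  refine ⟨P x' y' (i + 1) - P x y (i + 1), fun k => ?_, fun k => ?_, ?_⟩
  · rw [hP' k, hP' (k + 1), hy k]
    simp only [add_left_inj]
    ring
  · rw [hP' k, hP' (k + 1), hx k]
    simp only [add_left_inj]
    ring
  · rcases huv with ⟨rfl, rfl, h⟩ | ⟨rfl, rfl, h⟩ <;> omega

theorem rowF_eq_some_of_shift {n ℓ : ℕ} [NeZero n] {i : Fin (n - 1)} {x y : Row n ℓ}
    (h : ∀ k, (y.1 k : ℤ) =
      x.1 k + ((if k = lo i + 1 then 1 else 0) - (if k = lo i then 1 else 0))) :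
    rowF i x = some y := by
  refine rowF_eq_some fun k => ?_
  have := h k
  rw [lo_add_one] at this
  split_ifs at * <;> omega

theorem shift_of_rowF {n ℓ : ℕ} [NeZero n] {i : Fin (n - 1)} {x y : Row n ℓ}
    (h : rowF i x = some y) (k : Fin n) : (y.1 k : ℤ) =
      x.1 k + ((if k = lo i + 1 then 1 else 0) - (if k = lo i then 1 else 0)) := by
  have : y.1 k + (if k = lo i then 1 else 0) = x.1 k + (if k = hi i then 1 else 0) :=
    (rowCrystal_isNormal n ℓ).content_f h k
  rw [lo_add_one]
  split_ifs at * <;> omega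

theorem R_comm_f {n : ℕ} [NeZero n] (ℓ m : ℕ) (i : Fin (n - 1))
    (b : Row n ℓ × Row n m) :
    ((rowCrystal n m).tensor (rowCrystal n ℓ)).f i (R n ℓ m b) =
      (((rowCrystal n ℓ).tensor (rowCrystal n m)).f i b).map (R n ℓ m) := by
  obtain ⟨r, rfl⟩ : ∃ r, n = r + 2 := ⟨n - 2, by have := i.2; omega⟩
  obtain ⟨x, y⟩ := b
  have a1 := fun k => R_fst_apply x y k
  have a2 := fun k => R_snd_apply x y k
  cases hf : ((rowCrystal (r + 2) ℓ).tensor (rowCrystal (r + 2) m)).f i (x, y) with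
  | none =>
    -- Vanishing of `f_i` means `φ_i = 0`, that is, `y` has no letter `i` and `x i ≤ y (i + 1)`. The
    -- local formulas for `P`, used with unchanged functions, give the same two conditions for the
    -- image.
    have h0 := ((rowCrystal_isNormal (r + 2) ℓ).tensor
      (rowCrystal_isNormal (r + 2) m)).phi_of_none hf
    simp only [Crystal.tensor, rowCrystal] at h0
    rw [← lo_add_one] at h0
    obtain ⟨N, t, ⟨h1, h2, h3⟩, h4⟩ := exists_P_local (x := x.1) (y := y.1) (x' := x.1)
      (y' := y.1) (i := lo i) (fun k _ _ => rfl) (fun k _ _ => rfl)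
    have b1 := a1 (lo i)
    have b2 := a2 (lo i)
    have b3 := a2 (lo i + 1)
    have c1 : (R (r + 2) ℓ m (x, y)).2.1 (lo i) = 0 := by omega
    have c2 : (R (r + 2) ℓ m (x, y)).1.1 (lo i) ≤ (R (r + 2) ℓ m (x, y)).2.1 (hi i) := by
      rw [← lo_add_one]
      omega
    refine Eq.trans ?_ (congrArg (Option.map (R (r + 2) ℓ m)) hf).symm
    simp [Crystal.tensor, rowCrystal, rowF, c1, not_lt.2 c2]
  | some b' =>
    obtain ⟨x', y'⟩ := b'
    have key : ∃ u v : ℤ, (∀ k, (x'.1 k : ℤ) = x.1 k + u *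
          ((if k = lo i + 1 then 1 else 0) - (if k = lo i then 1 else 0))) ∧
        (∀ k, (y'.1 k : ℤ) = y.1 k + v *
          ((if k = lo i + 1 then 1 else 0) - (if k = lo i then 1 else 0))) ∧
        ((u = 1 ∧ v = 0 ∧ y.1 (lo i + 1) < x.1 (lo i)) ∨
          (u = 0 ∧ v = 1 ∧ x.1 (lo i) ≤ y.1 (lo i + 1))) := by
      rw [lo_add_one]
      rcases Crystal.tensor_f_eq_some _ _ hf with ⟨h1, h2, rfl⟩ | ⟨h1, h2, rfl⟩
      · refine ⟨1, 0, fun k => ?_, fun k => by simp, .inl ⟨rfl, rfl, h1⟩⟩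
        rw [one_mul, ← lo_add_one]
        exact shift_of_rowF h2 k
      · refine ⟨0, 1, fun k => by simp, fun k => ?_, .inr ⟨rfl, rfl, h1⟩⟩
        rw [one_mul, ← lo_add_one]
        exact shift_of_rowF h2 k
    obtain ⟨u, v, hx, hy, huv⟩ := key
    have a1' := fun k => R_fst_apply x' y' k
    have a2' := fun k => R_snd_apply x' y' k
    obtain ⟨w, e1, e2, e3⟩ := R_shift hx hy huv
    simp only [← a1, ← a1', ← a2, ← a2'] at e1 e2 e3
    rw [lo_add_one] at e3
    refine Eq.trans ?_ (congrArg (Option.map (R (r + 2) ℓ m)) hf).symm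
    rcases e3 with ⟨hu, hv, h⟩ | ⟨hu, hv, h⟩
    · have g1 : rowF i (R (r + 2) ℓ m (x, y)).1 = some (R (r + 2) ℓ m (x', y')).1 :=
        rowF_eq_some_of_shift fun k => by rw [e1, hv, one_mul]
      have g2 : (R (r + 2) ℓ m (x', y')).2 = (R (r + 2) ℓ m (x, y)).2 :=
        Subtype.ext (funext fun k => by have := e2 k; rw [hu, zero_mul] at this; omega)
      refine (Crystal.tensor_f_left (rowCrystal (r + 2) m) (rowCrystal (r + 2) ℓ) ?_ g1).trans ?_
      · exact_mod_cast h
      · exact congrArg some (Prod.ext rfl g2.symm)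
    · have g1 : rowF i (R (r + 2) ℓ m (x, y)).2 = some (R (r + 2) ℓ m (x', y')).2 :=
        rowF_eq_some_of_shift fun k => by rw [e2, hu, one_mul]
      have g2 : (R (r + 2) ℓ m (x', y')).1 = (R (r + 2) ℓ m (x, y)).1 :=
        Subtype.ext (funext fun k => by have := e1 k; rw [hv, zero_mul] at this; omega)
      refine (Crystal.tensor_f_right (rowCrystal (r + 2) m) (rowCrystal (r + 2) ℓ) ?_ g1).trans ?_
      · exact_mod_cast h
      · exact congrArg some (Prod.ext g2.symm rfl)

/-- A highest weight element of `B_ℓ ⊗ B` has only letters `1` in the row. -/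
theorem eq_zero_of_eps_eq_zero {n ℓ : ℕ} {x : Row n ℓ} (h : ∀ i, (rowCrystal n ℓ).eps i x = 0)
    {k : Fin n} (hk : k.1 ≠ 0) : x.1 k = 0 := by
  have := h ⟨k.1 - 1, by have := k.2; omega⟩
  simp only [rowCrystal, hi] at this
  convert this using 2
  apply Fin.ext
  simp only
  omega

theorem row_eq_of_eps_eq_zero {n ℓ : ℕ} {x y : Row n ℓ}
    (hx : ∀ i, (rowCrystal n ℓ).eps i x = 0) (hy : ∀ i, (rowCrystal n ℓ).eps i y = 0) :
    x = y := by
  have hsum : ∀ (x : Row n ℓ), (∀ i, (rowCrystal n ℓ).eps i x = 0) → ∀ k : Fin n, k.1 = 0 →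
      x.1 k = ℓ := by
    intro x hx k hk
    have := x.2
    rwa [Finset.sum_eq_single k (fun j _ hj => eq_zero_of_eps_eq_zero hx
      (fun h => hj (Fin.ext (h.trans hk.symm)))) (fun h => absurd (Finset.mem_univ _) h)] at this
  apply Subtype.ext
  funext k
  by_cases hk : k.1 = 0
  · rw [hsum x hx k hk, hsum y hy k hk]
  · rw [eq_zero_of_eps_eq_zero hx hk, eq_zero_of_eps_eq_zero hy hk]

theorem Crystal.IsHighest.fst {n : ℕ} {B C : Crystal n} {b : (B.tensor C).carrier}
    (h : (B.tensor C).IsHighest b) (i : Fin (n - 1)) : B.eps i b.1 = 0 := by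
  have := h i
  simp only [Crystal.tensor] at this
  omega

theorem Crystal.IsHighest.snd_le {n : ℕ} {B C : Crystal n} {b : (B.tensor C).carrier}
    (h : (B.tensor C).IsHighest b) (i : Fin (n - 1)) : C.eps i b.2 ≤ B.phi i b.1 := by
  have := h i
  simp only [Crystal.tensor] at this
  omega

/-- The highest weight elements of `B_ℓ ⊗ B_m` are determined by their weights. -/
theorem row_tensor_row_ext {n ℓ m : ℕ} {b c : Row n ℓ × Row n m}
    (hb : ((rowCrystal n ℓ).tensor (rowCrystal n m)).IsHighest b)
    (hc : ((rowCrystal n ℓ).tensor (rowCrystal n m)).IsHighest c)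
    (h : ∀ k, b.1.1 k + b.2.1 k = c.1.1 k + c.2.1 k) : b = c := by
  have h1 : b.1 = c.1 := row_eq_of_eps_eq_zero hb.fst hc.fst
  refine Prod.ext h1 (Subtype.ext (funext fun k => ?_))
  have := h k
  rw [h1] at this
  omega

theorem R_isMorphism (n ℓ m : ℕ) [NeZero n] :
    IsMorphism ((rowCrystal n ℓ).tensor (rowCrystal n m))
      ((rowCrystal n m).tensor (rowCrystal n ℓ)) (R n ℓ m) :=
  ((rowCrystal_isNormal n ℓ).tensor (rowCrystal_isNormal n m)).isMorphism
    ((rowCrystal_isNormal n m).tensor (rowCrystal_isNormal n ℓ)) (R_comm_f ℓ m)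
    (fun b => funext fun k => R_content b k)

/-- The composite is a morphism that preserves content, and highest weight elements of a product of
two rows are determined by their content; so it fixes all of them. -/
theorem R_R {n : ℕ} (ℓ m : ℕ) [NeZero n] (b : Row n ℓ × Row n m) : R n m ℓ (R n ℓ m b) = b := by
  have h := ((rowCrystal_isNormal n ℓ).tensor (rowCrystal_isNormal n m)).ext
    ((R_isMorphism n m ℓ).comp (R_isMorphism n ℓ m)) (isMorphism_id _) fun b hb =>
      row_tensor_row_ext ((R_isMorphism n m ℓ).isHighest ((R_isMorphism n ℓ m).isHighest hb)) hb
        fun k => (R_content _ k).trans (R_content b k)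
  exact congrFun h b

/-! ### The carrier description of `ι''` and `(ι'')⁻¹`, and their being mutually inverse. -/

theorem fin_induction_down {n : ℕ} [NeZero n] {p : Fin n → Prop} {a : Fin n} (ha : p a)
    (h : ∀ k, p (k + 1) → p k) (k : Fin n) : p k := by
  have key : ∀ (m : ℕ) (k : Fin n), k + Fin.ofNat n m = a → p k := by
    intro m
    induction m with
    | zero =>
      intro k hk
      have : Fin.ofNat n 0 = 0 := rfl
      rw [this, add_zero] at hk
      rwa [hk]
    | succ m ih =>
      intro k hk
      rw [ofNat_succ_aux] at hk
      exact h k (ih _ hk)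
  exact key (a - k).1 k ((add_ofNat_eq_iff _ _ (a - k).2).2 rfl)

theorem fin_induction_up {n : ℕ} [NeZero n] {p : Fin n → Prop} {a : Fin n} (ha : p a)
    (h : ∀ k, p k → p (k + 1)) (k : Fin n) : p k := by
  have key : ∀ (m : ℕ) (a : Fin n), p a → p (a + Fin.ofNat n m) := by
    intro m
    induction m with
    | zero =>
      intro a ha
      have : Fin.ofNat n 0 = 0 := rfl
      rwa [this, add_zero]
    | succ m ih =>
      intro a ha
      rw [ofNat_succ_aux]
      exact ih _ (h a ha)
  have := key (k - a).1 a ha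
  rwa [(add_ofNat_eq_iff k a (k - a).2).2 rfl] at this

theorem val_add_one_cases {n : ℕ} [NeZero n] (k : Fin n) :
    ((k + 1).1 = k.1 + 1 ∧ k.1 + 1 < n) ∨ ((k + 1).1 = 0 ∧ k.1 + 1 = n) := by
  rw [Fin.val_add, Fin.val_one', Nat.add_mod_mod]
  rcases Nat.lt_or_ge (k.1 + 1) n with h | h
  · exact .inl ⟨Nat.mod_eq_of_lt h, h⟩
  · have : k.1 + 1 = n := le_antisymm k.2 h
    exact .inr ⟨by rw [this, Nat.mod_self], this⟩

/-- The carrier of the map `ι''`, which runs through the letters cyclically downwards: `c k = 1`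
if the carrier is loaded when it leaves the letter `k`. -/
structure IsCarry {n : ℕ} [NeZero n] (x : Fin n → ℕ) (d : Fin n × Fin n) (c : Fin n → ℕ) :
    Prop where
  eq_max : ∀ k, c k = max (colCount d k) (c (k + 1) - x k)
  le_one : ∀ k, c k ≤ 1

/-- The carrier of the map `(ι'')⁻¹`, which runs through the letters cyclically upwards. -/
structure IsCocarry {n : ℕ} [NeZero n] (x : Fin n → ℕ) (d : Fin n × Fin n) (c : Fin n → ℕ) :
    Prop where
  eq_max : ∀ k, c (k + 1) = max (colCount d k) (c k - x k)
  le_one : ∀ k, c k ≤ 1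

theorem colCount_fst_pos {n : ℕ} (d : Fin n × Fin n) : 0 < colCount d d.1 := by
  simp [colCount]

/-- A cyclic recursion alone need not have a unique solution, but at a letter of the column the
carrier must be loaded. From there the recursion determines it all the way around. -/
theorem IsCarry.unique {n : ℕ} [NeZero n] {x : Fin n → ℕ} {d : Fin n × Fin n} {c c' : Fin n → ℕ}
    (h : IsCarry x d c) (h' : IsCarry x d c') (k : Fin n) : c k = c' k := by
  refine fin_induction_down (p := fun k => c k = c' k) (a := d.1) ?_ (fun k hk => ?_) k
  · have := colCount_fst_pos d
    have := h.eq_max d.1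
    have := h.le_one d.1
    have := h'.eq_max d.1
    have := h'.le_one d.1
    omega
  · rw [h.eq_max, h'.eq_max, hk]

theorem IsCocarry.unique {n : ℕ} [NeZero n] {x : Fin n → ℕ} {d : Fin n × Fin n}
    {c c' : Fin n → ℕ} (h : IsCocarry x d c) (h' : IsCocarry x d c') (k : Fin n) :
    c k = c' k := by
  refine fin_induction_up (p := fun k => c k = c' k) (a := d.1 + 1) ?_ (fun k hk => ?_) k
  · have := colCount_fst_pos d
    have := h.eq_max d.1
    have := h.le_one (d.1 + 1)
    have := h'.eq_max d.1
    have := h'.le_one (d.1 + 1)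
    omega
  · rw [h.eq_max, h'.eq_max, hk]

theorem max'_below {n : ℕ} {x : Fin n → ℕ} {b : Fin n} (h : (below x b).Nonempty) :
    0 < x ((below x b).max' h) ∧ (below x b).max' h < b ∧
      ∀ k, 0 < x k → k < b → k ≤ (below x b).max' h := by
  have h1 : 0 < x ((below x b).max' h) ∧ (below x b).max' h < b := by
    simpa [below] using (below x b).max'_mem h
  exact ⟨h1.1, h1.2, fun k hk hkb => Finset.le_max' _ _ (by simp [below, hk, hkb])⟩

theorem min'_above {n : ℕ} {x : Fin n → ℕ} {b : Fin n} (h : (above x b).Nonempty) :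
    0 < x ((above x b).min' h) ∧ b < (above x b).min' h ∧
      ∀ k, 0 < x k → b < k → (above x b).min' h ≤ k := by
  have h1 : 0 < x ((above x b).min' h) ∧ b < (above x b).min' h := by
    simpa [above] using (above x b).min'_mem h
  exact ⟨h1.1, h1.2, fun k hk hkb => Finset.min'_le _ _ (by simp [above, hk, hkb])⟩

theorem max'_letters {n : ℕ} {x : Fin n → ℕ} (h : (letters x).Nonempty) :
    0 < x ((letters x).max' h) ∧ ∀ k, 0 < x k → k ≤ (letters x).max' h := by
  have h1 : 0 < x ((letters x).max' h) := by
    simpa [letters] using (letters x).max'_mem h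
  exact ⟨h1, fun k hk => Finset.le_max' _ _ (by simp [letters, hk])⟩

theorem min'_letters {n : ℕ} {x : Fin n → ℕ} (h : (letters x).Nonempty) :
    0 < x ((letters x).min' h) ∧ ∀ k, 0 < x k → (letters x).min' h ≤ k := by
  have h1 : 0 < x ((letters x).min' h) := by
    simpa [letters] using (letters x).min'_mem h
  exact ⟨h1, fun k hk => Finset.min'_le _ _ (by simp [letters, hk])⟩

theorem not_below_nonempty {n : ℕ} {x : Fin n → ℕ} {b : Fin n} (h : ¬ (below x b).Nonempty)
    (k : Fin n) (hk : 0 < x k) : b ≤ k :=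
  not_lt.1 fun hkb => h ⟨k, by simp [below, hk, hkb]⟩

theorem not_above_nonempty {n : ℕ} {x : Fin n → ℕ} {b : Fin n} (h : ¬ (above x b).Nonempty)
    (k : Fin n) (hk : 0 < x k) : k ≤ b :=
  not_lt.1 fun hkb => h ⟨k, by simp [above, hk, hkb]⟩

/-- The column `d'` is obtained by `ι''` from the row `x` and the column `d`, in terms of the
carrier. -/
def IotaRel {n : ℕ} [NeZero n] (x : Fin n → ℕ) (d d' : Fin n × Fin n) : Prop :=
  ∃ c, IsCarry x d c ∧ ∀ k, colCount d' k + c k = colCount d k + c (k + 1)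

/-- The column `d'` is obtained by `(ι'')⁻¹` from the row `x` and the column `d`, in terms of the
carrier. -/
def IotaInvRel {n : ℕ} [NeZero n] (x : Fin n → ℕ) (d d' : Fin n × Fin n) : Prop :=
  ∃ c, IsCocarry x d c ∧ ∀ k, colCount d' k + c (k + 1) = colCount d k + c k

/-- A way to prove `IotaRel` by arithmetic: the carrier is loaded at the letters in `S`. -/
theorem IotaRel.of_set {n : ℕ} [NeZero n] {x : Fin n → ℕ} {d d' : Fin n × Fin n} (S : ℕ → Prop)
    [DecidablePred S]
    (h : ∀ (k k' : Fin n), (k'.1 = k.1 + 1 ∧ k.1 + 1 < n) ∨ (k'.1 = 0 ∧ k.1 + 1 = n) →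
      (S k ↔ (k.1 = d.1.1 ∨ k.1 = d.2.1) ∨ (S k' ∧ x k = 0)) ∧
      colCount d' k + (if S k then 1 else 0) = colCount d k + (if S k' then 1 else 0))
    (hd : d.1 < d.2) : IotaRel x d d' := by
  refine ⟨fun k => if S k then 1 else 0, ⟨fun k => ?_, fun k => ?_⟩, fun k => ?_⟩
  · have h1 := (h k (k + 1) (val_add_one_cases k)).1
    have h2 := colCount_eq ⟨d, hd⟩ k
    simp only [Domino.Has, Fin.ext_iff] at h2
    rw [h2]
    simp only [h1]
    rcases Nat.eq_zero_or_pos (x k) with h0 | h0 <;> split_ifs <;> first | omega | tauto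
  · split_ifs <;> omega
  · exact (h k (k + 1) (val_add_one_cases k)).2

theorem IotaInvRel.of_set {n : ℕ} [NeZero n] {x : Fin n → ℕ} {d d' : Fin n × Fin n}
    (S : ℕ → Prop) [DecidablePred S]
    (h : ∀ (k k' : Fin n), (k'.1 = k.1 + 1 ∧ k.1 + 1 < n) ∨ (k'.1 = 0 ∧ k.1 + 1 = n) →
      (S k' ↔ (k.1 = d.1.1 ∨ k.1 = d.2.1) ∨ (S k ∧ x k = 0)) ∧
      colCount d' k + (if S k' then 1 else 0) = colCount d k + (if S k then 1 else 0))
    (hd : d.1 < d.2) : IotaInvRel x d d' := by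
  refine ⟨fun k => if S k then 1 else 0, ⟨fun k => ?_, fun k => ?_⟩, fun k => ?_⟩
  · have h1 := (h k (k + 1) (val_add_one_cases k)).1
    have h2 := colCount_eq ⟨d, hd⟩ k
    simp only [Domino.Has, Fin.ext_iff] at h2
    rw [h2]
    simp only [h1]
    rcases Nat.eq_zero_or_pos (x k) with h0 | h0 <;> split_ifs <;> first | omega | tauto
  · split_ifs <;> omega
  · exact (h k (k + 1) (val_add_one_cases k)).2

/-- The carrier is loaded at each letter of the column and moves downwards, past the letter 1 to `n`
if necessary, until it meets a letter of the row. In each case of the definition the set `S` is the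
union of these cyclic intervals. -/
theorem iotaColumn_rel {n : ℕ} [NeZero n] (x : Fin n → ℕ) {β γ : Fin n} (h : β < γ)
    (hx : (letters x).Nonempty) : IotaRel x (β, γ) (iotaColumn x β γ) := by
  unfold iotaColumn
  rw [Fin.lt_def] at h
  split_ifs with h1 h2 h3 h5 h6
  · obtain ⟨p1, p2, p3⟩ := max'_below h1
    obtain ⟨q1, q2, q3⟩ := max'_below h2
    generalize (below x β).max' h1 = p at *
    generalize (below x γ).max' h2 = q at *
    refine IotaRel.of_set (fun k => (p < k ∧ k ≤ β) ∨ (q < k ∧ k ≤ γ)) (fun k k' hk => ?_) h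
    have p4 := p3 k
    have q4 := q3 k
    have pq := p3 q
    have qp := q3 p
    have p6 : k = p → 0 < x k := fun h => h ▸ p1
    have q6 : k = q → 0 < x k := fun h => h ▸ q1
    clear p3 q3
    simp only [colCount, Fin.ext_iff, Fin.lt_def, Fin.le_def] at *
    constructor
    · omega
    · split_ifs <;> omega
  · obtain ⟨p1, p2, p3⟩ := max'_below h1
    obtain ⟨q1, q2, q3⟩ := max'_below h2
    generalize (below x β).max' h1 = p at *
    generalize (below x γ).max' h2 = q at *
    -- No letter of the row lies in `[β, γ)`, so the load from `γ` reaches `β`, where the carrier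
    -- has no room for another letter; thus `β` stays in the column.
    refine IotaRel.of_set (fun k => p < k ∧ k ≤ γ) (fun k k' hk => ?_) h
    have p4 := p3 k
    have q4 := q3 k
    have pq := p3 q
    have qp := q3 p
    have p6 : k = p → 0 < x k := fun h => h ▸ p1
    have q6 : k = q → 0 < x k := fun h => h ▸ q1
    clear p3 q3
    simp only [colCount, Fin.ext_iff, Fin.lt_def, Fin.le_def] at *
    constructor
    · omega
    · split_ifs <;> omega
  · obtain ⟨p1, p2, p3⟩ := max'_below h1
    exact absurd ⟨_, by simpa [below] using ⟨p1, lt_trans p2 h⟩⟩ h2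
  · have r3 := not_below_nonempty h1
    obtain ⟨p1, p2, p3⟩ := max'_below h6
    obtain ⟨l1, l3⟩ := max'_letters hx
    generalize (below x γ).max' h6 = p at *
    generalize (letters x).max' hx = l at *
    -- The load from `β` finds no smaller letter in the row and wraps around to the largest letter
    -- `l`; the load from `γ` stops at `p`.
    refine IotaRel.of_set (fun k => k ≤ β ∨ l < k ∨ (p < k ∧ k ≤ γ)) (fun k k' hk => ?_) h
    have r4 := r3 k
    have p4 := p3 k
    have l4 := l3 k
    have rp := r3 p
    have rl := r3 l
    have pl := p3 l
    have lp := l3 p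
    have p6 : k = p → 0 < x k := fun h => h ▸ p1
    have l6 : k = l → 0 < x k := fun h => h ▸ l1
    clear r3 p3 l3
    simp only [colCount, Fin.ext_iff, Fin.lt_def, Fin.le_def] at *
    constructor
    · omega
    · split_ifs <;> omega
  · have r3 := not_below_nonempty h1
    have p3 := not_below_nonempty h6
    obtain ⟨l1, l3⟩ := max'_letters hx
    generalize (letters x).max' hx = l at *
    refine IotaRel.of_set (fun k => k ≤ γ ∨ l < k) (fun k k' hk => ?_) h
    have r4 := r3 k
    have p4 := p3 k
    have l4 := l3 k
    have rl := r3 l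
    have pl := p3 l
    have l6 : k = l → 0 < x k := fun h => h ▸ l1
    clear r3 p3 l3
    simp only [colCount, Fin.ext_iff, Fin.lt_def, Fin.le_def] at *
    constructor
    · omega
    · split_ifs <;> omega
  · have r3 := not_below_nonempty h1
    obtain ⟨l1, l3⟩ := max'_letters hx
    generalize (letters x).max' hx = l at *
    refine IotaRel.of_set (fun k => k ≤ β ∨ l < k) (fun k k' hk => ?_) h
    have r4 := r3 k
    have l4 := l3 k
    have rl := r3 l
    have l6 : k = l → 0 < x k := fun h => h ▸ l1
    clear r3 l3
    simp only [colCount, Fin.ext_iff, Fin.lt_def, Fin.le_def] at *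
    constructor
    · omega
    · split_ifs <;> omega

theorem iotaInvColumn_rel {n : ℕ} [NeZero n] (x : Fin n → ℕ) {α β : Fin n} (h : α < β)
    (hx : (letters x).Nonempty) : IotaInvRel x (α, β) (iotaInvColumn x α β) := by
  unfold iotaInvColumn
  rw [Fin.lt_def] at h
  rw [dif_pos hx]
  split_ifs with h1 h2 h3 h4
  · obtain ⟨p1, p2, p3⟩ := min'_above h1
    obtain ⟨q1, q2, q3⟩ := min'_above h2
    generalize (above x α).min' h1 = p at *
    generalize (above x β).min' h2 = q at *
    refine IotaInvRel.of_set (fun k => (α < k ∧ k ≤ p) ∨ (β < k ∧ k ≤ q)) (fun k k' hk => ?_) h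
    have p4 := p3 k
    have q4 := q3 k
    have pq := p3 q
    have qp := q3 p
    have p6 : k = p → 0 < x k := fun h => h ▸ p1
    have q6 : k = q → 0 < x k := fun h => h ▸ q1
    clear p3 q3
    simp only [colCount, Fin.ext_iff, Fin.lt_def, Fin.le_def] at *
    constructor
    · omega
    · split_ifs <;> omega
  · obtain ⟨p1, p2, p3⟩ := min'_above h1
    obtain ⟨q1, q2, q3⟩ := min'_above h2
    generalize (above x α).min' h1 = p at *
    generalize (above x β).min' h2 = q at *
    refine IotaInvRel.of_set (fun k => α < k ∧ k ≤ p) (fun k k' hk => ?_) h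
    have p4 := p3 k
    have q4 := q3 k
    have pq := p3 q
    have qp := q3 p
    have p6 : k = p → 0 < x k := fun h => h ▸ p1
    have q6 : k = q → 0 < x k := fun h => h ▸ q1
    clear p3 q3
    simp only [colCount, Fin.ext_iff, Fin.lt_def, Fin.le_def] at *
    constructor
    · omega
    · split_ifs <;> omega
  · obtain ⟨p1, p2, p3⟩ := min'_above h1
    have q3 := not_above_nonempty h2
    obtain ⟨l1, l3⟩ := min'_letters hx
    generalize (above x α).min' h1 = p at *
    generalize (letters x).min' hx = l at *
    -- Upwards, the load from `β` finds no larger letter and wraps around to the smallest letter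
    -- `l`.
    refine IotaInvRel.of_set (fun k => (α < k ∧ k ≤ p) ∨ β < k ∨ k ≤ l) (fun k k' hk => ?_) h
    have p4 := p3 k
    have q4 := q3 k
    have l4 := l3 k
    have pl := p3 l
    have qp := q3 p
    have ql := q3 l
    have lp := l3 p
    have p6 : k = p → 0 < x k := fun h => h ▸ p1
    have l6 : k = l → 0 < x k := fun h => h ▸ l1
    clear p3 q3 l3
    simp only [colCount, Fin.ext_iff, Fin.lt_def, Fin.le_def] at *
    constructor
    · omega
    · split_ifs <;> omega
  · obtain ⟨p1, p2, p3⟩ := min'_above h1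
    have q3 := not_above_nonempty h2
    obtain ⟨l1, l3⟩ := min'_letters hx
    generalize (above x α).min' h1 = p at *
    generalize (letters x).min' hx = l at *
    refine IotaInvRel.of_set (fun k => β < k ∨ k ≤ l) (fun k k' hk => ?_) h
    have p4 := p3 k
    have q4 := q3 k
    have l4 := l3 k
    have pl := p3 l
    have qp := q3 p
    have ql := q3 l
    have lp := l3 p
    have p6 : k = p → 0 < x k := fun h => h ▸ p1
    have l6 : k = l → 0 < x k := fun h => h ▸ l1
    clear p3 q3 l3
    simp only [colCount, Fin.ext_iff, Fin.lt_def, Fin.le_def] at *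
    constructor
    · omega
    · split_ifs <;> omega
  · have p3 := not_above_nonempty h1
    obtain ⟨l1, l3⟩ := min'_letters hx
    generalize (letters x).min' hx = l at *
    refine IotaInvRel.of_set (fun k => α < k ∨ k ≤ l) (fun k k' hk => ?_) h
    have p4 := p3 k
    have l4 := l3 k
    have pl := p3 l
    have l6 : k = l → 0 < x k := fun h => h ▸ l1
    clear p3 l3
    simp only [colCount, Fin.ext_iff, Fin.lt_def, Fin.le_def] at *
    constructor
    · omega
    · split_ifs <;> omega

theorem letters_nonempty {n ℓ : ℕ} (hℓ : 1 ≤ ℓ) (x : Row n ℓ) : (letters x.1).Nonempty := by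
  by_contra h
  have h0 : ∀ k, x.1 k = 0 := fun k => by
    by_contra hk
    exact h ⟨k, by simp [letters, Nat.pos_of_ne_zero hk]⟩
  have := x.2
  simp [h0] at this
  omega

theorem exchangeRow_add {n ℓ : ℕ} (x : Row n ℓ) (d d' : Fin n × Fin n) (h : IsExchange x.1 d d')
    (k : Fin n) : (exchangeRow x d d' h).1 k + colCount d' k = x.1 k + colCount d k := by
  obtain ⟨h1, h2, h3⟩ := h
  have h4 := colCount_eq ⟨d', h1⟩ k
  simp only [Domino.Has] at h4
  have h5 : 0 < colCount d' k → 0 < x.1 k + colCount d k := by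
    intro h
    rw [h4] at h
    have h6 : k = d'.1 ∨ k = d'.2 := by
      by_contra hc
      simp [hc] at h
    unfold colCount
    rcases h6 with rfl | rfl
    · rcases h2 with h2 | h2 | h2
      · omega
      · rw [if_pos h2]; omega
      · rw [if_pos h2]; omega
    · rcases h3 with h3 | h3 | h3
      · omega
      · rw [if_pos h3]; omega
      · rw [if_pos h3]; omega
  have h6 : colCount d' k ≤ 1 := colCount_le_one ⟨d', h1⟩ k
  change x.1 k + colCount d k - colCount d' k + colCount d' k = _
  omega

/-- The map `ι''` in terms of its carrier. -/
theorem iota_carry {n ℓ : ℕ} [NeZero n] (hℓ : 1 ≤ ℓ) (x : Row n ℓ) (d : Domino n) :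
    ∃ c, IsCarry x.1 d.1 c ∧
      (∀ k, colCount (iota n ℓ (x, d)).1.1 k + c k = colCount d.1 k + c (k + 1)) ∧
      (∀ k, (iota n ℓ (x, d)).2.1 k + c (k + 1) = x.1 k + c k) := by
  obtain ⟨c, h1, h2⟩ := iotaColumn_rel x.1 d.2 (letters_nonempty hℓ x)
  refine ⟨c, h1, h2, fun k => ?_⟩
  have h3 : (iota n ℓ (x, d)).2.1 k + colCount (iotaColumn x.1 d.1.1 d.1.2) k =
    x.1 k + colCount d.1 k :=
      exchangeRow_add _ _ _ (iotaColumn_isExchange _ _ _ d.2) _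
  have h4 : colCount (iotaColumn x.1 d.1.1 d.1.2) k + c k = colCount d.1 k + c (k + 1) := h2 k
  omega

/-- By uniqueness of the carrier, exhibiting any function that satisfies the recursion suffices to
compute `(ι'')⁻¹`, with no return to its case list. -/
theorem iotaInv_eq {n ℓ : ℕ} [NeZero n] (hℓ : 1 ≤ ℓ) {x x' : Row n ℓ} {d d' : Domino n}
    {c : Fin n → ℕ} (hc : IsCocarry x.1 d.1 c)
    (hd : ∀ k, colCount d'.1 k + c (k + 1) = colCount d.1 k + c k)
    (hx : ∀ k, x'.1 k + c k = x.1 k + c (k + 1)) : iotaInv n ℓ (d, x) = (x', d') := by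
  obtain ⟨c', h1, h2⟩ := iotaInvColumn_rel x.1 d.2 (letters_nonempty hℓ x)
  obtain rfl : c = c' := funext fun k => hc.unique h1 k
  have h3 : ∀ k, colCount (iotaInvColumn x.1 d.1.1 d.1.2) k = colCount d'.1 k := by
    intro k
    have h4 : colCount (iotaInvColumn x.1 d.1.1 d.1.2) k + c (k + 1) = colCount d.1 k + c k := h2 k
    have := hd k
    omega
  refine Prod.ext (Subtype.ext (funext fun k => ?_)) (Domino.ext_of_colCount h3)
  have h4 : (iotaInv n ℓ (d, x)).1.1 k + colCount (iotaInvColumn x.1 d.1.1 d.1.2) k =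
    x.1 k + colCount d.1 k :=
      exchangeRow_add _ _ _ (iotaInvColumn_isExchange _ _ _ d.2) _
  have := hx k
  have := hd k
  have := h3 k
  simp only
  omega

/-- The downward carrier of the incoming pair satisfies the upward recursion for the outgoing pair,
and the conservation laws at each letter are symmetric under this reversal. -/
theorem iotaInv_iota {n ℓ : ℕ} [NeZero n] (hℓ : 1 ≤ ℓ) :
    Function.LeftInverse (iotaInv n ℓ) (iota n ℓ) := by
  rintro ⟨x, d⟩
  obtain ⟨c, h1, h2, h3⟩ := iota_carry hℓ x d
  refine iotaInv_eq hℓ (x := (iota n ℓ (x, d)).2) (d := (iota n ℓ (x, d)).1) (c := c)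
    ⟨fun k => ?_, h1.le_one⟩ (fun k => (h2 k).symm) (fun k => (h3 k).symm)
  have := h1.eq_max k
  have := h1.le_one k
  have := h1.le_one (k + 1)
  have := h2 k
  have := h3 k
  omega

theorem finite_row (n ℓ : ℕ) : Finite (Row n ℓ) := by
  have : Function.Injective fun (x : Row n ℓ) (k : Fin n) => (⟨x.1 k, by
      have := Finset.single_le_sum (fun j _ => Nat.zero_le (x.1 j)) (Finset.mem_univ k)
      rw [x.2] at this
      omega⟩ : Fin (ℓ + 1)) := fun x y h => by
    apply Subtype.ext
    funext k
    exact congrArg Fin.val (congrFun h k)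
  exact Finite.of_injective _ this

/-- Source and target of `ι''` are finite and in bijection by swapping the factors, so its
injectivity implies surjectivity. -/
theorem iota_iotaInv {n ℓ : ℕ} [NeZero n] (hℓ : 1 ≤ ℓ) :
    Function.RightInverse (iotaInv n ℓ) (iota n ℓ) := by
  have := finite_row n ℓ
  exact ((iotaInv_iota hℓ).rightInverse_of_surjective (by
    have h := (iotaInv_iota (n := n) hℓ).injective.comp (Prod.swap_injective (α := Domino n))
    exact (Finite.injective_iff_surjective.1 h).of_comp))

/-! ### The map `ι''` commutes with the crystal operators. -/

/-- The effect of `f_i` on the tensor product of a row and a column is that of `f_i` on the image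
under `ι''`, in terms of the numbers of letters. -/
theorem iota_shift {n : ℕ} [NeZero n] {x x' : Fin n → ℕ} {d d' : Domino n} {c : Fin n → ℕ}
    {i : Fin n} {u v : ℤ} (hne : i ≠ i + 1) (hc : IsCarry x d.1 c)
    (hx : ∀ k, (x' k : ℤ) = x k + u * ((if k = i + 1 then 1 else 0) - (if k = i then 1 else 0)))
    (hd : ∀ k, (colCount d'.1 k : ℤ) =
      colCount d.1 k + v * ((if k = i + 1 then 1 else 0) - (if k = i then 1 else 0)))
    (huv : (u = 1 ∧ v = 0 ∧ colCount d.1 (i + 1) - colCount d.1 i < x i) ∨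
      (u = 0 ∧ v = 1 ∧ x i ≤ colCount d.1 (i + 1) - colCount d.1 i)) :
    ∃ (c' : Fin n → ℕ) (w : ℤ), IsCarry x' d'.1 c' ∧
      (∀ k, (c' k : ℤ) = c k + w * (if k = i + 1 then 1 else 0)) ∧
      ((u + w = 0 ∧ v - w = 1 ∧ (x (i + 1) + c (i + 1) - c (i + 1 + 1) : ℤ) <
          (colCount d.1 i + c (i + 1) - c i) - (colCount d.1 (i + 1) + c (i + 1 + 1) - c (i + 1))) ∨
        (u + w = 1 ∧ v - w = 0 ∧
          (colCount d.1 i + c (i + 1) - c i) - (colCount d.1 (i + 1) + c (i + 1 + 1) - c (i + 1)) ≤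
          (x (i + 1) + c (i + 1) - c (i + 1 + 1) : ℤ))) := by
  have hx0 := hx i
  have hx1 := hx (i + 1)
  have hd0 := hd i
  have hd1 := hd (i + 1)
  rw [if_neg hne, if_pos rfl] at hx0 hd0
  rw [if_neg hne.symm, if_pos rfl] at hx1 hd1
  have b0 := colCount_le_one d i
  have b1 := colCount_le_one d (i + 1)
  have b0' := colCount_le_one d' i
  have b1' := colCount_le_one d' (i + 1)
  have e0 := hc.eq_max i
  have e1 := hc.eq_max (i + 1)
  have l0 := hc.le_one i
  have l1 := hc.le_one (i + 1)
  have l2 := hc.le_one (i + 1 + 1)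
  -- The new carrier is the old one with its value at `i + 1` recomputed from the recursion. The
  -- recursion at `i` still returns the old value, by the tensor product rule in `huv`; at all other
  -- letters its data are unchanged.
  set m := max (colCount d'.1 (i + 1)) (c (i + 1 + 1) - x' (i + 1)) with hm
  refine ⟨fun k => if k = i + 1 then m else c k, m - c (i + 1),
    ⟨fun k => ?_, fun k => ?_⟩, fun k => ?_, ?_⟩
  · by_cases hk1 : k = i + 1
    · subst hk1
      have : i + 1 + 1 ≠ i + 1 := fun h => hne (add_right_cancel h).symm
      rw [if_pos rfl, if_neg this]
    · rw [if_neg hk1]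
      by_cases hk0 : k = i
      · subst hk0
        rw [if_pos rfl]
        rcases huv with ⟨rfl, rfl, h⟩ | ⟨rfl, rfl, h⟩ <;> omega
      · rw [if_neg (fun h => hk0 (add_right_cancel h)), hc.eq_max k]
        have h1 := hx k
        have h2 := hd k
        rw [if_neg hk1, if_neg hk0] at h1 h2
        simp only [sub_zero, mul_zero, add_zero, Nat.cast_inj] at h1 h2
        rw [h1, h2]
  · have := hc.le_one k
    split_ifs <;> omega
  · by_cases hk : k = i + 1
    · subst hk; simp
    · simp [hk]
  · rcases huv with ⟨rfl, rfl, h⟩ | ⟨rfl, rfl, h⟩ <;> omega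

theorem shift_of_dominoF {n : ℕ} [NeZero n] {i : Fin (n - 1)} {d e : Domino n}
    (h : dominoF i d = some e) (k : Fin n) : (colCount e.1 k : ℤ) =
      colCount d.1 k + ((if k = lo i + 1 then 1 else 0) - (if k = lo i then 1 else 0)) := by
  have := colCount_dominoF h k
  rw [lo_add_one]
  split_ifs at * <;> omega

theorem dominoF_eq_some_of_shift {n : ℕ} [NeZero n] {i : Fin (n - 1)} {d e : Domino n}
    (h : ∀ k, (colCount e.1 k : ℤ) =
      colCount d.1 k + ((if k = lo i + 1 then 1 else 0) - (if k = lo i then 1 else 0))) :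
    dominoF i d = some e := by
  refine dominoF_eq_some fun k => ?_
  have := h k
  rw [lo_add_one] at this
  split_ifs at * <;> omega

theorem iota_comm_f {n ℓ : ℕ} [NeZero n] (hℓ : 1 ≤ ℓ) (i : Fin (n - 1))
    (b : Row n ℓ × Domino n) :
    ((dominoCrystal n).tensor (rowCrystal n ℓ)).f i (iota n ℓ b) =
      (((rowCrystal n ℓ).tensor (dominoCrystal n)).f i b).map (iota n ℓ) := by
  obtain ⟨x, d⟩ := b
  obtain ⟨c, hc, a1, a2⟩ := iota_carry hℓ x d
  have hne : (lo i : Fin n) ≠ lo i + 1 := by rw [lo_add_one]; exact lo_ne_hi i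
  have a1lo := a1 (lo i)
  have a1hi := a1 (hi i)
  have a2lo := a2 (lo i)
  have a2hi := a2 (hi i)
  have hphi := dominoCrystal_phi i (iota n ℓ (x, d)).1
  cases hf : ((rowCrystal n ℓ).tensor (dominoCrystal n)).f i (x, d) with
  | none =>
    have h0 := ((rowCrystal_isNormal n ℓ).tensor (dominoCrystal_isNormal n)).phi_of_none hf
    have h1 : max (colCount d.1 (lo i) - colCount d.1 (hi i))
        (x.1 (lo i) + (colCount d.1 (lo i) - colCount d.1 (hi i)) -
          (colCount d.1 (hi i) - colCount d.1 (lo i))) = 0 := by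
      rw [← dominoCrystal_phi, ← dominoCrystal_eps]
      exact h0
    have e0 := hc.eq_max (lo i)
    have e1 := hc.eq_max (hi i)
    have l0 := hc.le_one (lo i)
    have l1 := hc.le_one (hi i)
    have l2 := hc.le_one (hi i + 1)
    have b0 := colCount_le_one d (lo i)
    have b1 := colCount_le_one d (hi i)
    rw [lo_add_one] at a1lo a2lo e0
    have c1 : (iota n ℓ (x, d)).2.1 (lo i) = 0 := by omega
    have c2 : ¬ (iota n ℓ (x, d)).2.1 (hi i) < (dominoCrystal n).phi i (iota n ℓ (x, d)).1 := by
      rw [hphi]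
      omega
    refine Eq.trans ?_ (congrArg (Option.map (iota n ℓ)) hf).symm
    have g1 : rowF i (iota n ℓ (x, d)).2 = none := by simp [rowF, c1]
    refine (if_neg c2).trans ?_
    exact congrArg (Option.map _) g1
  | some b' =>
    obtain ⟨x', d'⟩ := b'
    have key : ∃ u v : ℤ, (∀ k, (x'.1 k : ℤ) = x.1 k + u *
          ((if k = lo i + 1 then 1 else 0) - (if k = lo i then 1 else 0))) ∧
        (∀ k, (colCount (Subtype.val d') k : ℤ) = colCount d.1 k + v *
          ((if k = lo i + 1 then 1 else 0) - (if k = lo i then 1 else 0))) ∧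
        ((u = 1 ∧ v = 0 ∧ colCount d.1 (lo i + 1) - colCount d.1 (lo i) < x.1 (lo i)) ∨
          (u = 0 ∧ v = 1 ∧ x.1 (lo i) ≤ colCount d.1 (lo i + 1) - colCount d.1 (lo i))) := by
      rcases Crystal.tensor_f_eq_some _ _ hf with ⟨h1, h2, rfl⟩ | ⟨h1, h2, rfl⟩
      · replace h1 := lt_of_eq_of_lt (dominoCrystal_eps i d').symm h1
        rw [← lo_add_one] at h1
        exact ⟨1, 0, fun k => by rw [one_mul]; exact shift_of_rowF h2 k, fun k => by simp,
          .inl ⟨rfl, rfl, h1⟩⟩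
      · replace h1 := le_of_le_of_eq h1 (dominoCrystal_eps i d)
        rw [← lo_add_one] at h1
        exact ⟨0, 1, fun k => by simp, fun k => by rw [one_mul]; exact shift_of_dominoF h2 k,
          .inr ⟨rfl, rfl, h1⟩⟩
    obtain ⟨u, v, hx, hd, huv⟩ := key
    obtain ⟨c', w, hc', hw, e3⟩ := iota_shift hne hc hx hd huv
    obtain ⟨c'', hc'', a1', a2'⟩ := iota_carry hℓ x' d'
    -- The locally modified carrier is the true carrier of the pair obtained by `f_i`, so the two
    -- images can be compared letter by letter.
    obtain rfl : c' = c'' := funext fun k => hc'.unique hc'' k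
    have e1 : ∀ k, (colCount (iota n ℓ (x', d')).1.1 k : ℤ) = colCount (iota n ℓ (x, d)).1.1 k +
        (v - w) * ((if k = lo i + 1 then 1 else 0) - (if k = lo i then 1 else 0)) := by
      intro k
      have h1 := congrArg (Nat.cast (R := ℤ)) (a1 k)
      have h2 := congrArg (Nat.cast (R := ℤ)) (a1' k)
      push_cast at h1 h2
      rw [hw, hw, hd k] at h2
      simp only [add_left_inj] at h2
      linear_combination h2 - h1
    have e2 : ∀ k, ((iota n ℓ (x', d')).2.1 k : ℤ) = (iota n ℓ (x, d)).2.1 k +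
        (u + w) * ((if k = lo i + 1 then 1 else 0) - (if k = lo i then 1 else 0)) := by
      intro k
      have h1 := congrArg (Nat.cast (R := ℤ)) (a2 k)
      have h2 := congrArg (Nat.cast (R := ℤ)) (a2' k)
      push_cast at h1 h2
      rw [hw, hw, hx k] at h2
      simp only [add_left_inj] at h2
      linear_combination h2 - h1
    rw [lo_add_one] at e3 a1lo a2lo
    refine Eq.trans ?_ (congrArg (Option.map (iota n ℓ)) hf).symm
    rcases e3 with ⟨hu, hv, h⟩ | ⟨hu, hv, h⟩
    · have g1 : dominoF i (iota n ℓ (x, d)).1 = some (iota n ℓ (x', d')).1 :=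
        dominoF_eq_some_of_shift fun k => by rw [e1, hv, one_mul]
      have g2 : (iota n ℓ (x', d')).2 = (iota n ℓ (x, d)).2 :=
        Subtype.ext (funext fun k => by have := e2 k; rw [hu, zero_mul] at this; omega)
      refine (Crystal.tensor_f_left (dominoCrystal n) (rowCrystal n ℓ) ?_ g1).trans ?_
      · rw [hphi]
        change (iota n ℓ (x, d)).2.1 (hi i) < _
        omega
      · exact congrArg some (Prod.ext rfl g2.symm)
    · have g1 : rowF i (iota n ℓ (x, d)).2 = some (iota n ℓ (x', d')).2 :=
        rowF_eq_some_of_shift fun k => by rw [e2, hu, one_mul]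
      have g2 : (iota n ℓ (x', d')).1 = (iota n ℓ (x, d)).1 :=
        Domino.ext_of_colCount fun k => by have := e1 k; rw [hv, zero_mul] at this; omega
      refine (Crystal.tensor_f_right (dominoCrystal n) (rowCrystal n ℓ) ?_ g1).trans ?_
      · refine hphi.le.trans ?_
        change _ ≤ (iota n ℓ (x, d)).2.1 (hi i)
        omega
      · exact congrArg some (Prod.ext g2.symm rfl)

theorem iota_content {n ℓ : ℕ} (b : Row n ℓ × Domino n) (k : Fin n) :
    colCount (iota n ℓ b).1.1 k + (iota n ℓ b).2.1 k = b.1.1 k + colCount b.2.1 k := by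
  rw [add_comm]
  exact exchangeRow_add b.1 b.2.1 _ (iotaColumn_isExchange _ _ _ b.2.2) k

theorem iota_isMorphism {n ℓ : ℕ} [NeZero n] (hℓ : 1 ≤ ℓ) :
    IsMorphism ((rowCrystal n ℓ).tensor (dominoCrystal n))
      ((dominoCrystal n).tensor (rowCrystal n ℓ)) (iota n ℓ) :=
  ((rowCrystal_isNormal n ℓ).tensor (dominoCrystal_isNormal n)).isMorphism
    ((dominoCrystal_isNormal n).tensor (rowCrystal_isNormal n ℓ)) (iota_comm_f hℓ)
    (fun b => funext fun k => iota_content b k)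

/-! ### Uniform properties of `σ`, `σ_1` and `σ_2`: involutive, morphisms, content-preserving. -/

/-- The number of letters `k` in an element of `B_λ`. -/
def Shape.content {n : ℕ} : (s : Shape) → (s.crystal n).carrier → Fin n → ℕ
  | .row _ => fun x => x.1
  | .col => fun d k => colCount d.1 k

/-- The shape is not the empty row. -/
def Shape.IsPos : Shape → Prop
  | .row ℓ => 1 ≤ ℓ
  | .col => True

theorem sigma_sigma {n : ℕ} [NeZero n] {s t : Shape} (hs : s.IsPos) (ht : t.IsPos)
    (b : ((s.crystal n).tensor (t.crystal n)).carrier) : sigma n t s (sigma n s t b) = b := by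
  cases s with
  | row ℓ =>
    cases t with
    | row m => exact R_R ℓ m b
    | col => exact iotaInv_iota hs b
  | col =>
    cases t with
    | row m => exact iota_iotaInv ht b
    | col => rfl

theorem sigma_isMorphism {n : ℕ} [NeZero n] {s t : Shape} (hs : s.IsPos) (ht : t.IsPos) :
    IsMorphism ((s.crystal n).tensor (t.crystal n)) ((t.crystal n).tensor (s.crystal n))
      (sigma n s t) := by
  cases s with
  | row ℓ =>
    cases t with
    | row m => exact R_isMorphism n ℓ m
    | col => exact iota_isMorphism hs
  | col =>
    cases t with
    | row m => exact (iota_isMorphism ht).inverse (iotaInv_iota ht) (iota_iotaInv ht)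
    | col => exact isMorphism_id _

theorem sigma_content {n : ℕ} [NeZero n] (s t : Shape)
    (b : ((s.crystal n).tensor (t.crystal n)).carrier) (k : Fin n) :
    t.content (sigma n s t b).1 k + s.content (sigma n s t b).2 k =
      s.content b.1 k + t.content b.2 k := by
  cases s with
  | row ℓ =>
    cases t with
    | row m => exact R_content b k
    | col => exact iota_content b k
  | col =>
    cases t with
    | row m =>
      exact (exchangeRow_add (Prod.snd b) (Prod.fst b).1 _
        (iotaInvColumn_isExchange _ _ _ (Prod.fst b).2) k).trans (add_comm _ _)
    | col => exact rfl

theorem sigma₁_sigma₁ {n : ℕ} [NeZero n] {s t u : Shape} (hs : s.IsPos) (ht : t.IsPos)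
    (b : Triple n s t u) : sigma₁ (sigma₁ b) = b := by
  have h := sigma_sigma hs ht (b.1, b.2.1)
  exact congrArg (fun p : (s.crystal n).carrier × (t.crystal n).carrier => (p.1, p.2, b.2.2)) h

theorem sigma₂_sigma₂ {n : ℕ} [NeZero n] {s t u : Shape} (ht : t.IsPos) (hu : u.IsPos)
    (b : Triple n s t u) : sigma₂ (sigma₂ b) = b :=
  Prod.ext rfl (sigma_sigma ht hu b.2)

theorem sigma₁_isMorphism {n : ℕ} [NeZero n] {s t : Shape} (u : Shape) (hs : s.IsPos)
    (ht : t.IsPos) :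
    IsMorphism ((s.crystal n).tensor ((t.crystal n).tensor (u.crystal n)))
      ((t.crystal n).tensor ((s.crystal n).tensor (u.crystal n))) sigma₁ :=
  (sigma_isMorphism hs ht).tensor_left _

theorem sigma₂_isMorphism {n : ℕ} [NeZero n] (s : Shape) {t u : Shape} (ht : t.IsPos)
    (hu : u.IsPos) :
    IsMorphism ((s.crystal n).tensor ((t.crystal n).tensor (u.crystal n)))
      ((s.crystal n).tensor ((u.crystal n).tensor (t.crystal n))) sigma₂ :=
  (sigma_isMorphism ht hu).id_tensor _

/-- The number of letters `k` in an element of a threefold tensor product. -/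
def tripleContent {n : ℕ} {s t u : Shape} (b : Triple n s t u) (k : Fin n) : ℕ :=
  s.content b.1 k + (t.content b.2.1 k + u.content b.2.2 k)

theorem sigma₁_content {n : ℕ} [NeZero n] {s t u : Shape} (b : Triple n s t u) :
    tripleContent (sigma₁ b) = tripleContent b := by
  funext k
  have := sigma_content s t (b.1, b.2.1) k
  unfold tripleContent
  rw [← add_assoc, ← add_assoc]
  exact congrArg (· + _) this

theorem sigma₂_content {n : ℕ} [NeZero n] {s t u : Shape} (b : Triple n s t u) :
    tripleContent (sigma₂ b) = tripleContent b := by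
  funext k
  exact congrArg (_ + ·) (sigma_content t u b.2 k)

/-! ### Highest weight elements and the braid relation for two rows and a column. -/

/-- The columns `(1,2)`, `(1,3)`, `(2,3)`, `(3,4)` are those in highest weight elements. -/
theorem highest_row_row_col {n ℓ m : ℕ} {x : Row n ℓ} {y : Row n m} {d : Domino n}
    (h : ((rowCrystal n ℓ).tensor ((rowCrystal n m).tensor (dominoCrystal n))).IsHighest
      (x, y, d)) :
    (∀ k : Fin n, k.1 ≠ 0 → x.1 k = 0) ∧ (∀ k : Fin n, 2 ≤ k.1 → y.1 k = 0) ∧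
    (∀ i, y.1 (hi i) ≤ x.1 (lo i)) ∧
    ((d.1.1.1 = 0 ∧ d.1.2.1 = 1) ∨ (d.1.1.1 = 0 ∧ d.1.2.1 = 2) ∨ (d.1.1.1 = 1 ∧ d.1.2.1 = 2) ∨
      (d.1.1.1 = 2 ∧ d.1.2.1 = 3)) ∧
    (d.1.1.1 = 0 → d.1.2.1 = 2 → ∀ k : Fin n, k.1 = 1 → 1 ≤ y.1 k) := by
  have hx : ∀ k : Fin n, k.1 ≠ 0 → x.1 k = 0 := fun k hk => eq_zero_of_eps_eq_zero h.fst hk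
  have key : ∀ i : Fin (n - 1), max (y.1 (hi i))
      (y.1 (hi i) + (colCount d.1 (hi i) - colCount d.1 (lo i)) - y.1 (lo i)) ≤ x.1 (lo i) := by
    intro i
    rw [← dominoCrystal_eps]
    exact h.snd_le i
  have hy : ∀ k : Fin n, 2 ≤ k.1 → y.1 k = 0 := by
    intro k hk
    have h1 := key ⟨k.1 - 1, by omega⟩
    have h2 : hi (n := n) ⟨k.1 - 1, by omega⟩ = k := Fin.ext (by simp only [hi]; omega)
    rw [h2, hx (lo _) (by simp only [lo]; omega)] at h1
    omega
  -- For letters from 4 on (index at least 3), neither row contains the preceding letter, so nothing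
  -- in the rows can compensate `ε_i` of the column; the preceding letter must be in the column
  -- itself.
  have hcol : ∀ k : Fin n, 3 ≤ k.1 → d.Has k → ∃ j : Fin n, j.1 + 1 = k.1 ∧ d.Has j := by
    intro k hk hdk
    have h1 := key ⟨k.1 - 1, by omega⟩
    have h2 : hi (n := n) ⟨k.1 - 1, by omega⟩ = k := Fin.ext (by simp only [hi]; omega)
    rw [h2, hx (lo _) (by simp only [lo]; omega), hy (lo _) (by simp only [lo]; omega)] at h1
    refine ⟨lo ⟨k.1 - 1, by omega⟩, by simp only [lo]; omega, ?_⟩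
    rw [← colCount_pos_iff] at hdk ⊢
    omega
  have hlt : d.1.1.1 < d.1.2.1 := d.2
  refine ⟨hx, hy, fun i => by have := key i; omega, ?_, fun h0 h2 k hk => ?_⟩
  · have h1 : ¬ 3 ≤ d.1.1.1 := fun hge => by
      obtain ⟨j, hj, hdj⟩ := hcol _ hge (.inl rfl)
      simp only [Domino.Has, Fin.ext_iff] at hdj
      omega
    by_cases h2 : 3 ≤ d.1.2.1
    · obtain ⟨j, hj, hdj⟩ := hcol _ h2 (.inr rfl)
      simp only [Domino.Has, Fin.ext_iff] at hdj
      omega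
    · omega
  · have hn := d.1.2.2
    have h1 := key ⟨1, by omega⟩
    have e1 : lo (n := n) ⟨1, by omega⟩ = k := Fin.ext (by simp only [lo]; omega)
    have e2 : hi (n := n) ⟨1, by omega⟩ = d.1.2 := Fin.ext (by simp only [hi]; omega)
    rw [e1, e2, hx k (by omega), hy d.1.2 (by omega), colCount_eq, colCount_eq] at h1
    have : ¬ d.Has k := by simp only [Domino.Has, Fin.ext_iff]; omega
    rw [if_pos (.inr rfl), if_neg this] at h1
    omega

theorem colCount_of_val {n : ℕ} {d : Domino n} {a b : ℕ} (h1 : d.1.1.1 = a) (h2 : d.1.2.1 = b)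
    (k : Fin n) : colCount d.1 k = (if k.1 = a then 1 else 0) + (if k.1 = b then 1 else 0) := by
  simp only [colCount, Fin.ext_iff, h1, h2]

theorem val_of_colCount {n : ℕ} {d : Domino n} {a b : ℕ} (hab : a < b)
    (h : ∀ k : Fin n, colCount d.1 k = (if k.1 = a then 1 else 0) + (if k.1 = b then 1 else 0))
    (hb : b < n) : d.1.1.1 = a ∧ d.1.2.1 = b := by
  have hlt : d.1.1.1 < d.1.2.1 := d.2
  have hd : d = ⟨(⟨a, by omega⟩, ⟨b, hb⟩), hab⟩ := Domino.ext_of_colCount fun k => by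
    rw [h]
    simp only [colCount, Fin.ext_iff]
  rw [hd]
  exact ⟨rfl, rfl⟩

/-- The carrier is loaded everywhere except at the letter 2, which the row supplies: the column
(1,3) becomes (2,3), and the row exchanges a 2 for a 1. -/
theorem iota_col_one_three {n ℓ : ℕ} [NeZero n] (hℓ : 1 ≤ ℓ) {y : Row n ℓ} {d : Domino n}
    (h1 : d.1.1.1 = 0) (h2 : d.1.2.1 = 2) (hy : ∀ k : Fin n, 2 ≤ k.1 → y.1 k = 0)
    (hy1 : ∀ k : Fin n, k.1 = 1 → 1 ≤ y.1 k) :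
    ((iota n ℓ (y, d)).1.1.1.1 = 1 ∧ (iota n ℓ (y, d)).1.1.2.1 = 2) ∧
      ∀ k, (iota n ℓ (y, d)).2.1 k + (if k.1 = 1 then 1 else 0) =
        y.1 k + (if k.1 = 0 then 1 else 0) := by
  have hn := d.1.2.2
  have hcol := colCount_of_val h1 h2
  have hcarry : IsCarry y.1 d.1 (fun k => if k.1 = 1 then 0 else 1) := by
    refine ⟨fun k => ?_, fun k => by split_ifs <;> omega⟩
    rw [hcol]
    have := val_add_one_cases k
    have := hy k
    have := hy1 k
    split_ifs <;> omega
  obtain ⟨c, hc, e1, e2⟩ := iota_carry hℓ y d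
  obtain rfl : c = fun k => if k.1 = 1 then 0 else 1 := funext fun k => hc.unique hcarry k
  refine ⟨val_of_colCount (by omega) (fun k => ?_) (by omega), fun k => ?_⟩
  · have := e1 k
    have := val_add_one_cases k
    rw [hcol] at *
    simp only at *
    split_ifs at * <;> omega
  · have := e2 k
    have := val_add_one_cases k
    simp only at *
    split_ifs at * <;> omega

/-- The load from 3 passes through 2 and is set down at 1, so that the column (2,3) becomes (1,2)
and the row exchanges a 1 for a 3. -/
theorem iota_col_two_three {n ℓ : ℕ} [NeZero n] (hℓ : 1 ≤ ℓ) {x : Row n ℓ} {d : Domino n}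
    (h1 : d.1.1.1 = 1) (h2 : d.1.2.1 = 2) (hx : ∀ k : Fin n, k.1 ≠ 0 → x.1 k = 0)
    (hx0 : ∀ k : Fin n, k.1 = 0 → 1 ≤ x.1 k) :
    ((iota n ℓ (x, d)).1.1.1.1 = 0 ∧ (iota n ℓ (x, d)).1.1.2.1 = 1) ∧
      ∀ k, (iota n ℓ (x, d)).2.1 k + (if k.1 = 0 then 1 else 0) =
        x.1 k + (if k.1 = 2 then 1 else 0) := by
  have hn := d.1.2.2
  have hcol := colCount_of_val h1 h2
  have hcarry : IsCarry x.1 d.1 (fun k => if k.1 = 1 ∨ k.1 = 2 then 1 else 0) := by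
    refine ⟨fun k => ?_, fun k => by split_ifs <;> omega⟩
    rw [hcol]
    have := val_add_one_cases k
    have := hx k
    have := hx0 k
    split_ifs <;> omega
  obtain ⟨c, hc, e1, e2⟩ := iota_carry hℓ x d
  obtain rfl : c = fun k => if k.1 = 1 ∨ k.1 = 2 then 1 else 0 :=
    funext fun k => hc.unique hcarry k
  refine ⟨val_of_colCount (by omega) (fun k => ?_) (by omega), fun k => ?_⟩
  · have := e1 k
    have := val_add_one_cases k
    rw [hcol] at *
    simp only at *
    split_ifs at * <;> omega
  · have := e2 k
    have := val_add_one_cases k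
    simp only at *
    split_ifs at * <;> omega

/-- This propagates a known value of `R` along `f_i` when `f_i` acts on the first factor both before
and after `R`. It gives values of `R` outside the highest weight elements without evaluating `P`. -/
theorem R_of_rowF {n ℓ m : ℕ} [NeZero n] {i : Fin (n - 1)} {x z : Row n ℓ} {y : Row n m}
    {x' z' : Row n m} {y' : Row n ℓ} (h : R n ℓ m (x, y) = (x', y')) (hx : rowF i x = some z)
    (hx' : rowF i x' = some z') (hlt : y.1 (hi i) < x.1 (lo i))
    (hlt' : y'.1 (hi i) < x'.1 (lo i)) : R n ℓ m (z, y) = (z', y') := by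
  have h1 := (rowCrystal n ℓ).tensor_f_left (rowCrystal n m) (c := y) hlt hx
  have h2 := (rowCrystal n m).tensor_f_left (rowCrystal n ℓ) (c := y') hlt' hx'
  have h3 := R_comm_f ℓ m i (x, y)
  rw [h] at h3
  have h4 := (h3.symm.trans h2)
  exact Option.some.inj ((congrArg (Option.map (R n ℓ m)) h1).symm.trans h4)

theorem exists_rowF {n ℓ : ℕ} {i : Fin (n - 1)} {x : Row n ℓ} (h : 0 < x.1 (lo i)) :
    ∃ z, rowF i x = some z ∧
      ∀ k, z.1 k + (if k = lo i then 1 else 0) = x.1 k + (if k = hi i then 1 else 0) := by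
  cases hz : rowF i x with
  | none => simp [rowF, h] at hz
  | some z => exact ⟨z, rfl, (rowCrystal_isNormal n ℓ).content_f hz⟩

theorem apply_zero_of_eq_zero {n ℓ : ℕ} {x : Row n ℓ} (hx : ∀ k : Fin n, k.1 ≠ 0 → x.1 k = 0)
    (k : Fin n) (hk : k.1 = 0) : x.1 k = ℓ := by
  have := x.2
  rwa [Finset.sum_eq_single k (fun j _ hj => hx j (fun h => hj (Fin.ext (h.trans hk.symm))))
    (fun h => absurd (Finset.mem_univ _) h)] at this

theorem row_tensor_row_isHighest {n ℓ m : ℕ} {x : Row n ℓ} {y : Row n m}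
    (hx : ∀ k : Fin n, k.1 ≠ 0 → x.1 k = 0) (hyx : ∀ i, y.1 (hi i) ≤ x.1 (lo i)) :
    ((rowCrystal n ℓ).tensor (rowCrystal n m)).IsHighest (x, y) := by
  intro i
  have h1 := hx (hi i) (by simp [hi])
  have h2 := hyx i
  simp only [Crystal.tensor, rowCrystal]
  omega

/-- The braid relation on the highest weight elements with the column `(1,3)`. -/
theorem braid_of_highest {n ℓ m : ℕ} [NeZero n] (hℓ : 1 ≤ ℓ) (hm : 1 ≤ m)
    {b : Triple n (.row ℓ) (.row m) .col}
    (hb : ((rowCrystal n ℓ).tensor ((rowCrystal n m).tensor (dominoCrystal n))).IsHighest b)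
    (h0 : (Subtype.val b.2.2).1.1 = 0) (h2 : (Subtype.val b.2.2).2.1 = 2) :
    sigma₁ (sigma₂ (sigma₁ b)) = sigma₂ (sigma₁ (sigma₂ b)) := by
  obtain ⟨x, y, d⟩ := b
  change Row n ℓ at x
  change Row n m at y
  change Domino n at d
  change d.1.1.1 = 0 at h0
  change d.1.2.1 = 2 at h2
  have hn := d.1.2.2
  obtain ⟨hx, hy, hyx, -, hy1⟩ := highest_row_row_col hb
  replace hy1 := hy1 h0 h2
  have hfst : ∀ k : Fin n, k.1 = 0 → x.1 k = ℓ := apply_zero_of_eq_zero hx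
  obtain ⟨x', y', hp⟩ : ∃ x' y', R n ℓ m (x, y) = (x', y') := ⟨_, _, rfl⟩
  have hp' := (congrArg ((rowCrystal n m).tensor (rowCrystal n ℓ)).IsHighest hp).mp
    ((R_isMorphism n ℓ m).isHighest (row_tensor_row_isHighest hx hyx))
  have hx' : ∀ k : Fin n, k.1 ≠ 0 → x'.1 k = 0 := fun k hk => eq_zero_of_eps_eq_zero hp'.fst hk
  have hfst' : ∀ k : Fin n, k.1 = 0 → x'.1 k = m := apply_zero_of_eq_zero hx'
  have hpc : ∀ k, x'.1 k + y'.1 k = x.1 k + y.1 k := fun k => by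
    have := R_content (x, y) k
    rw [hp] at this
    exact this
  obtain ⟨e, y₁, hq⟩ : ∃ e y₁, iota n m (y, d) = (e, y₁) := ⟨_, _, rfl⟩
  obtain ⟨e', y₁', hq'⟩ : ∃ e' y₁', iota n ℓ (y', d) = (e', y₁') := ⟨_, _, rfl⟩
  obtain ⟨⟨he1, he2⟩, hy₁⟩ := iota_col_one_three hm h0 h2 hy hy1
  obtain ⟨⟨he1', he2'⟩, hy₁'⟩ := iota_col_one_three hℓ (y := y') h0 h2
    (fun k hk => by have := hpc k; have := hy k hk; have := hx k (by omega); omega)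
    (fun k hk => by have := hpc k; have := hy1 k hk; have := hx' k (by omega); omega)
  rw [hq] at he1 he2 hy₁
  rw [hq'] at he1' he2' hy₁'
  simp only at he1 he2 hy₁ he1' he2' hy₁'
  obtain ⟨g, x₁, hr⟩ : ∃ g x₁, iota n ℓ (x, e) = (g, x₁) := ⟨_, _, rfl⟩
  obtain ⟨g', x₁', hr'⟩ : ∃ g' x₁', iota n m (x', e') = (g', x₁') := ⟨_, _, rfl⟩
  obtain ⟨⟨hg1, hg2⟩, hx₁⟩ := iota_col_two_three hℓ he1 he2 hx
    (fun k hk => by rw [hfst k hk]; exact hℓ)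
  obtain ⟨⟨hg1', hg2'⟩, hx₁'⟩ := iota_col_two_three hm he1' he2' hx'
    (fun k hk => by rw [hfst' k hk]; exact hm)
  rw [hr] at hg1 hg2 hx₁
  rw [hr'] at hg1' hg2' hx₁'
  simp only at hg1 hg2 hx₁ hg1' hg2' hx₁'
  have hgg : g = g' := Domino.ext_of_colCount fun k => by
    rw [colCount_of_val hg1 hg2, colCount_of_val hg1' hg2']
  -- the image of `x ⊗ y₁`, from which that of `x₁ ⊗ y₁` is obtained by `f_1` and `f_2`
  have hyx₁ : ∀ i, y₁.1 (hi i) ≤ x.1 (lo i) := fun i => by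
    have := hyx i
    have := hy₁ (hi i)
    have : (hi i : Fin n).1 ≠ 0 := by simp [hi]
    split_ifs at * <;> omega
  obtain ⟨x'', y'', hp₁⟩ : ∃ x'' y'', R n ℓ m (x, y₁) = (x'', y'') := ⟨_, _, rfl⟩
  have hp₁' := (congrArg ((rowCrystal n m).tensor (rowCrystal n ℓ)).IsHighest hp₁).mp
    ((R_isMorphism n ℓ m).isHighest (row_tensor_row_isHighest hx hyx₁))
  -- Both first factors come from highest weight elements, so they consist of letters 1 only; the
  -- second factors then agree by content.
  obtain rfl : x'' = x' := row_eq_of_eps_eq_zero hp₁'.fst hp'.fst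
  obtain rfl : y'' = y₁' := Subtype.ext (funext fun k => by
    have h1 := R_content (x, y₁) k
    rw [hp₁] at h1
    have := hpc k
    have := hy₁ k
    have := hy₁' k
    simp only at h1
    omega)
  have hyle : ∀ k, y.1 k ≤ m := fun k => by
    have := Finset.single_le_sum (fun j _ => Nat.zero_le (y.1 j)) (Finset.mem_univ k)
    rwa [y.2] at this
  have hl0 : (lo (n := n) ⟨0, by omega⟩).1 = 0 := rfl
  have hh0 : (hi (n := n) ⟨0, by omega⟩).1 = 1 := rfl
  have hl1 : (lo (n := n) ⟨1, by omega⟩).1 = 1 := rfl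
  have hh1 : (hi (n := n) ⟨1, by omega⟩).1 = 2 := rfl
  -- The inequality is strict because `y₁` has one letter 2 fewer than `y`, and `y` has at most as
  -- many letters 2 as `x` has letters 1.
  have hlt : y₁.1 (hi ⟨0, by omega⟩) < x.1 (lo ⟨0, by omega⟩) := by
    have := hyx ⟨0, by omega⟩
    have h := hy₁ (hi ⟨0, by omega⟩)
    rw [if_pos hh0, if_neg (by omega)] at h
    omega
  -- All letters 2 of `x ⊗ y` end up in `y'`, so their number is that in `y`, at most `m`; one of
  -- them is lost in passing to `y₁'`, while `x'` has `m` letters 1.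
  have hlt' : y''.1 (hi ⟨0, by omega⟩) < x''.1 (lo ⟨0, by omega⟩) := by
    have := hyle (hi ⟨0, by omega⟩)
    have := hfst' _ hl0
    have := hpc (hi ⟨0, by omega⟩)
    have := hx (hi ⟨0, by omega⟩) (by omega)
    have := hx' (hi ⟨0, by omega⟩) (by omega)
    have h := hy₁' (hi ⟨0, by omega⟩)
    rw [if_pos hh0, if_neg (by omega)] at h
    omega
  obtain ⟨z, hz, hzc⟩ := exists_rowF (i := ⟨0, by omega⟩) (x := x) (by omega)
  obtain ⟨z', hz', hzc'⟩ := exists_rowF (i := ⟨0, by omega⟩) (x := x'') (by omega)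
  have hRz := R_of_rowF hp₁ hz hz' hlt hlt'
  have hzl : 0 < z.1 (lo ⟨1, by omega⟩) := by
    have h := hzc (lo ⟨1, by omega⟩)
    rw [if_neg (by rw [Fin.ext_iff]; omega), if_pos (Fin.ext (hl1.trans hh0.symm))] at h
    omega
  have hzl' : 0 < z'.1 (lo ⟨1, by omega⟩) := by
    have h := hzc' (lo ⟨1, by omega⟩)
    rw [if_neg (by rw [Fin.ext_iff]; omega), if_pos (Fin.ext (hl1.trans hh0.symm))] at h
    omega
  obtain ⟨v, hv, hvc⟩ := exists_rowF hzl
  obtain ⟨v', hv', hvc'⟩ := exists_rowF hzl'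
  -- Now `f_2` acts on the single letter 2 just created; the second factors contain no letter 3.
  have hRv := R_of_rowF hRz hv hv'
    (by
      have h := hy₁ (hi ⟨1, by omega⟩)
      have := hy (hi ⟨1, by omega⟩) (by omega)
      rw [if_neg (by omega), if_neg (by omega)] at h
      omega)
    (by
      have h := hy₁' (hi ⟨1, by omega⟩)
      have := hpc (hi ⟨1, by omega⟩)
      have := hy (hi ⟨1, by omega⟩) (by omega)
      have := hx (hi ⟨1, by omega⟩) (by omega)
      rw [if_neg (by omega), if_neg (by omega)] at h
      omega)
  obtain rfl : v = x₁ := Subtype.ext (funext fun k => by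
    have := hx₁ k
    have := hzc k
    have := hvc k
    simp only [Fin.ext_iff, hl0, hh0, hl1, hh1] at *
    omega)
  obtain rfl : v' = x₁' := Subtype.ext (funext fun k => by
    have := hx₁' k
    have := hzc' k
    have := hvc' k
    simp only [Fin.ext_iff, hl0, hh0, hl1, hh1] at *
    omega)
  have hL : sigma₁ (sigma₂ (sigma₁ ((x, y, d) : Triple n (.row ℓ) (.row m) .col))) =
      (((iota n m ((R n ℓ m (x, y)).1, (iota n ℓ ((R n ℓ m (x, y)).2, d)).1)).1,
        (iota n m ((R n ℓ m (x, y)).1, (iota n ℓ ((R n ℓ m (x, y)).2, d)).1)).2,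
        (iota n ℓ ((R n ℓ m (x, y)).2, d)).2) : Domino n × Row n m × Row n ℓ) := rfl
  have hRt : sigma₂ (sigma₁ (sigma₂ ((x, y, d) : Triple n (.row ℓ) (.row m) .col))) =
      (((iota n ℓ (x, (iota n m (y, d)).1)).1,
        R n ℓ m ((iota n ℓ (x, (iota n m (y, d)).1)).2, (iota n m (y, d)).2)) :
          Domino n × Row n m × Row n ℓ) := rfl
  refine hL.trans (Eq.trans ?_ hRt.symm)
  simp only [hp, hq, hq', hr, hr', hRv, hgg]
  rfl

/-- The columns `(1,2)`, `(2,3)`, `(3,4)` differ in the letters greater than `2`. -/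
theorem Domino.eq_of_colCount_eq {n : ℕ} {d e : Domino n}
    (hd : (d.1.1.1 = 0 ∧ d.1.2.1 = 1) ∨ (d.1.1.1 = 0 ∧ d.1.2.1 = 2) ∨
      (d.1.1.1 = 1 ∧ d.1.2.1 = 2) ∨ (d.1.1.1 = 2 ∧ d.1.2.1 = 3))
    (he : (e.1.1.1 = 0 ∧ e.1.2.1 = 1) ∨ (e.1.1.1 = 0 ∧ e.1.2.1 = 2) ∨
      (e.1.1.1 = 1 ∧ e.1.2.1 = 2) ∨ (e.1.1.1 = 2 ∧ e.1.2.1 = 3))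
    (hd' : ¬ (d.1.1.1 = 0 ∧ d.1.2.1 = 2)) (he' : ¬ (e.1.1.1 = 0 ∧ e.1.2.1 = 2))
    (h : ∀ k : Fin n, 2 ≤ k.1 → colCount d.1 k = colCount e.1 k) : d = e := by
  have hk : ∀ k : Fin n, 2 ≤ k.1 → (d.Has k ↔ e.Has k) := fun k hk => by
    rw [← colCount_pos_iff, ← colCount_pos_iff, h k hk]
  have k1 := hk d.1.1
  have k2 := hk d.1.2
  have k3 := hk e.1.1
  have k4 := hk e.1.2
  simp only [Domino.Has, Fin.ext_iff] at k1 k2 k3 k4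
  have key : d.1.1.1 = e.1.1.1 ∧ d.1.2.1 = e.1.2.1 := by
    generalize d.1.1.1 = a at *
    generalize d.1.2.1 = b at *
    generalize e.1.1.1 = a' at *
    generalize e.1.2.1 = b' at *
    rcases hd with ⟨rfl, rfl⟩ | ⟨rfl, rfl⟩ | ⟨rfl, rfl⟩ | ⟨rfl, rfl⟩ <;>
      rcases he with ⟨rfl, rfl⟩ | ⟨rfl, rfl⟩ | ⟨rfl, rfl⟩ | ⟨rfl, rfl⟩ <;> simp at *
  exact Subtype.ext (Prod.ext (Fin.ext key.1) (Fin.ext key.2))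

/-- The braid relation for two rows and a column. -/
theorem braid_row_row_col {n ℓ m : ℕ} [NeZero n] (hℓ : 1 ≤ ℓ) (hm : 1 ≤ m) :
    BraidRelation n (.row ℓ) (.row m) .col := by
  have pℓ : (Shape.row ℓ).IsPos := hℓ
  have pm : (Shape.row m).IsPos := hm
  have pc : Shape.col.IsPos := trivial
  -- As the `σ` are involutive, the braid relation is equivalent to `T = id`.
  let T : Triple n (.row ℓ) (.row m) .col → Triple n (.row ℓ) (.row m) .col :=
    fun b => sigma₂ (sigma₁ (sigma₂ (sigma₁ (sigma₂ (sigma₁ b)))))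
  have hT : IsMorphism _ _ T :=
    (sigma₂_isMorphism (.row ℓ) pc pm).comp ((sigma₁_isMorphism (.row m) pc pℓ).comp
      ((sigma₂_isMorphism .col pm pℓ).comp ((sigma₁_isMorphism (.row ℓ) pm pc).comp
        ((sigma₂_isMorphism (.row m) pℓ pc).comp (sigma₁_isMorphism .col pℓ pm)))))
  have hTc : ∀ b, tripleContent (T b) = tripleContent b := fun b => by
    simp only [T, sigma₁_content, sigma₂_content]
  have hTinj : Function.Injective T := fun a b hab => by
    have h1 := congrArg sigma₂ hab
    rw [sigma₂_sigma₂ pc pm, sigma₂_sigma₂ pc pm] at h1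
    replace h1 := congrArg sigma₁ h1
    rw [sigma₁_sigma₁ pc pℓ, sigma₁_sigma₁ pc pℓ] at h1
    replace h1 := congrArg sigma₂ h1
    rw [sigma₂_sigma₂ pm pℓ, sigma₂_sigma₂ pm pℓ] at h1
    replace h1 := congrArg sigma₁ h1
    rw [sigma₁_sigma₁ pm pc, sigma₁_sigma₁ pm pc] at h1
    replace h1 := congrArg sigma₂ h1
    rw [sigma₂_sigma₂ pℓ pc, sigma₂_sigma₂ pℓ pc] at h1
    replace h1 := congrArg sigma₁ h1
    rwa [sigma₁_sigma₁ pℓ pm, sigma₁_sigma₁ pℓ pm] at h1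
  have hfix : ∀ b : Triple n (.row ℓ) (.row m) .col,
      ((rowCrystal n ℓ).tensor ((rowCrystal n m).tensor (dominoCrystal n))).IsHighest b →
      (Subtype.val b.2.2).1.1 = 0 → (Subtype.val b.2.2).2.1 = 2 → T b = b := by
    intro b hb h0 h2
    simp only [T]
    rw [braid_of_highest hℓ hm hb h0 h2, sigma₂_sigma₂ pℓ pm, sigma₁_sigma₁, sigma₂_sigma₂]
    all_goals assumption
  have hid : T = id := by
    refine (((rowCrystal_isNormal n ℓ).tensor
      ((rowCrystal_isNormal n m).tensor (dominoCrystal_isNormal n))).ext hT (isMorphism_id _) ?_)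
    intro b hb
    have hb' := hT.isHighest hb
    have hc := hTc b
    by_cases h1 : (Subtype.val b.2.2).1.1 = 0 ∧ (Subtype.val b.2.2).2.1 = 2
    · exact hfix b hb h1.1 h1.2
    by_cases h2 : (Subtype.val (T b).2.2).1.1 = 0 ∧ (Subtype.val (T b).2.2).2.1 = 2
    -- Here `T b` has the column (1,3), so `T (T b) = T b`, and injectivity gives `T b = b`.
    · exact hTinj (hfix _ hb' h2.1 h2.2)
    generalize T b = b' at *
    obtain ⟨x, y, d⟩ := b
    obtain ⟨x', y', d'⟩ := b'
    obtain ⟨-, hy, -, hd, -⟩ := highest_row_row_col hb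
    obtain ⟨-, hy', -, hd', -⟩ := highest_row_row_col hb'
    obtain rfl : x = x' := row_eq_of_eps_eq_zero hb.fst hb'.fst
    have hc' : ∀ k, Subtype.val y' k + colCount (Subtype.val d') k =
        Subtype.val y k + colCount (Subtype.val d) k := fun k =>
      Nat.add_left_cancel (congrFun hc k)
    -- With (1,3) excluded on both sides, the column is determined by its letters greater than 2,
    -- and none of these occur in the rows.
    obtain rfl : d' = d := Domino.eq_of_colCount_eq hd' hd h2 h1 fun k hk => by
      have := hc' k
      have := hy k hk
      have := hy' k hk
      omega
    obtain rfl : y = y' := Subtype.ext (funext fun k => (Nat.add_right_cancel (hc' k)).symm)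
    rfl
  intro b
  have h := congrFun hid b
  simp only [T, id] at h
  replace h := congrArg sigma₂ h
  rw [sigma₂_sigma₂ pc pm] at h
  replace h := congrArg sigma₁ h
  rw [sigma₁_sigma₁ pc pℓ] at h
  replace h := congrArg sigma₂ h
  rwa [sigma₂_sigma₂ pm pℓ] at h

/-! ### The remaining orders of the factors, and the theorem. -/

/-- Evaluating the relation at `σ_2 b` and applying `σ_1` cancels one involution on each side, which
leaves the relation for the exchanged factors. `BraidRelation.swap_left` is the same with `σ_1` and
`σ_2` interchanged. -/
theorem BraidRelation.swap_right {n : ℕ} [NeZero n] {s t u : Shape} (ht : t.IsPos)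
    (hu : u.IsPos) (h : BraidRelation n s t u) : BraidRelation n s u t := by
  intro b
  have h1 := congrArg sigma₁ (h (sigma₂ b))
  rw [sigma₂_sigma₂ hu ht, sigma₁_sigma₁ ht hu] at h1
  exact h1.symm

theorem BraidRelation.swap_left {n : ℕ} [NeZero n] {s t u : Shape} (hs : s.IsPos)
    (ht : t.IsPos) (h : BraidRelation n s t u) : BraidRelation n t s u := by
  intro b
  have h1 := congrArg sigma₂ (h (sigma₁ b))
  rw [sigma₁_sigma₁ ht hs, sigma₂_sigma₂ hs ht] at h1
  exact h1.symm

end ColouredBBS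

theorem mainTheorem5 (n : ℕ) [NeZero n] (hn : 2 ≤ n) (ℓ₁ ℓ₂ : ℕ) (hℓ₁ : 1 ≤ ℓ₁) (hℓ₂ : 1 ≤ ℓ₂) :
    (ColouredBBS.IsCrystalIso
        ((ColouredBBS.rowCrystal n ℓ₁).tensor (ColouredBBS.rowCrystal n ℓ₂))
        ((ColouredBBS.rowCrystal n ℓ₂).tensor (ColouredBBS.rowCrystal n ℓ₁))
        (ColouredBBS.R n ℓ₁ ℓ₂)) ∧
    (ColouredBBS.IsCrystalIso
        ((ColouredBBS.rowCrystal n ℓ₁).tensor (ColouredBBS.dominoCrystal n))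
        ((ColouredBBS.dominoCrystal n).tensor (ColouredBBS.rowCrystal n ℓ₁))
        (ColouredBBS.iota n ℓ₁)) ∧
    (Function.LeftInverse (ColouredBBS.iotaInv n ℓ₁) (ColouredBBS.iota n ℓ₁) ∧
      Function.RightInverse (ColouredBBS.iotaInv n ℓ₁) (ColouredBBS.iota n ℓ₁)) ∧
    (ColouredBBS.BraidRelation n (.row ℓ₁) (.row ℓ₂) .col ∧
      ColouredBBS.BraidRelation n (.row ℓ₁) .col (.row ℓ₂) ∧
      ColouredBBS.BraidRelation n .col (.row ℓ₁) (.row ℓ₂)) := by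
  have h1 : (ColouredBBS.Shape.row ℓ₁).IsPos := hℓ₁
  have h2 : (ColouredBBS.Shape.row ℓ₂).IsPos := hℓ₂
  have hc : ColouredBBS.Shape.col.IsPos := trivial
  have hL := ColouredBBS.iotaInv_iota (n := n) hℓ₁
  have hR := ColouredBBS.iota_iotaInv (n := n) hℓ₁
  have hbr := (ColouredBBS.braid_row_row_col (n := n) hℓ₁ hℓ₂).swap_right h2 hc
  exact ⟨⟨Function.bijective_iff_has_inverse.2
      ⟨_, ColouredBBS.R_R ℓ₁ ℓ₂, ColouredBBS.R_R ℓ₂ ℓ₁⟩, ColouredBBS.R_comm_f ℓ₁ ℓ₂⟩,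
    ⟨Function.bijective_iff_has_inverse.2 ⟨_, hL, hR⟩, ColouredBBS.iota_comm_f hℓ₁⟩, ⟨hL, hR⟩,
    ColouredBBS.braid_row_row_col hℓ₁ hℓ₂, hbr, hbr.swap_left h1 hc⟩
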